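/- **Definitions.** A *graphon* $(W,S,\mu)$ is a symmetric integrable function $W:S\times S\to\mathbb R$, where $(S,\mu)$ is a $\sigma$-finite measure space ($W$ need be neither bounded nor non-negative). A *trivial extension* of $(W,S,\mu)$ is a graphon $(\widetilde W,\widetilde S,\widetilde\mu)$ such that $(S,\mu)$ is (up to isomorphism) a measurable subspace of $(\widetilde S,\widetilde\mu)$, with $\widetilde W=W$ on $S\times S$ and $\widetilde W=0$ elsewhere. The *cut norm* of $F\in L^1(S\times S,\mu\times\mu)$ is $\|F\|_{\square}=\sup_{T,U}\bigl|\int_{T\times U}F\,d(\mu\times\mu)\bigr|$, over measurable $T,U\subseteq S$. A *coupling* of $(S_1,\mu_1)$ and $(S_2,\mu_2)$ is a pair of measure-preserving maps $\varphi_i:(S,\mu)\to(S_i,\mu_i)$, $i=1,2$, defined on a common measure space; it is *special* if $S=S_1\times S_2$ and $\varphi_1,\varphi_2$ are the two projections. Write $W^{\varphi}(x,y)=W(\varphi(x),\varphi(y))$. The *cut metric* is defined by $$\delta_\square(W_1,W_2)=\inf_{(\varphi_1,\varphi_2)}\bigl\|W_1^{\varphi_1}-W_2^{\varphi_2}\bigr\|_\square\quad\text{if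 }\mu_1(S_1)=\mu_2(S_2),$$ with the infimum over all couplings of $S_1$ and $S_2$ (the norm is taken on the space of the coupling); if $\mu_1(S_1)\neq\mu_2(S_2)$, then $\delta_\square(W_1,W_2)$ is defined as $\delta_\square(W_1',W_2')$ for trivial extensions $W_i'$ of $W_i$ to spaces of equal total mass (the value does not depend on the choice; for definiteness, adjoin to each $S_i$ a disjoint copy of $[0,\infty)$ with Lebesgue measure). **Theorem.** Let $(W_1,S_1)$ and $(W_2,S_2)$ be graphons, where $S_i=(S_i,\mathcal F_i,\mu_i)$ are $\sigma$-finite Borel measure spaces (that is, $(S_i,\mathcal F_i)$ is isomorphic to a Borel subset of a Polish space with its Borel $\sigma$-algebra), $i=1,2$. Then there exist trivial extensions $(\widetilde W_i,\widetilde S_i)$ of $(W_i,S_i)$, $i=1,2$, and a coupling $(\varphi_1,\varphi_2)$ of $\widetilde S_1$ and $\widetilde S_2$ such that $$\delta_\square(W_1,W_2)=\delta_\square(\widetilde W_1,\widetilde W_2)=\bigl\|\widetilde W_1^{\varphi_1}-\widetilde W_2^{\varphi_2}\bigr\|_\square .$$ The coupling may be taken to be special. In particular, the infimum defining $\delta_\square(\widetilde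 W_1,\widetilde W_2)$ is attained. -/

import Mathlib

open MeasureTheory Set
open scoped ENNReal

universe u v

/-- A graphon `(W, S, μ)`: a symmetric integrable real function `W` on `S × S`, where `(S, μ)` is a
σ-finite measure space.  Neither boundedness nor positivity is required. -/
structure Graphon : Type (u + 1) where
  /-- the underlying set `S` -/
  space : Type u
  /-- the σ-algebra of `S` -/
  [measurableSpace : MeasurableSpace space]
  /-- the measure of `S` -/
  μ : Measure space
  [sigmaFinite : SigmaFinite μ]
  /-- the function `W` -/
  W : space → space → ℝ
  symm : ∀ x y, W x y = W y x
  integrable : Integrable (fun z : space × space => W z.1 z.2) (μ.prod μ)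

attribute [instance] Graphon.measurableSpace Graphon.sigmaFinite

/-- The cut norm `sup_{T,U} |∫_{T × U} F d(μ × μ)|`, over all measurable `T, U ⊆ S`.  (For integrable
`F` the set is bounded by the `L¹` norm of `F`.) -/
noncomputable def cutNorm {S : Type*} [MeasurableSpace S] (μ : Measure S) (F : S → S → ℝ) : ℝ :=
  sSup {r : ℝ | ∃ T U : Set S, MeasurableSet T ∧ MeasurableSet U ∧
    r = |∫ z in T ×ˢ U, F z.1 z.2 ∂(μ.prod μ)|}

/-- A coupling of two measure spaces: a pair of measure-preserving maps `φ₁ : S → S₁` and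
`φ₂ : S → S₂` defined on a common measure space `S`. -/
structure Coupling {S₁ : Type u} {S₂ : Type v} [MeasurableSpace S₁] [MeasurableSpace S₂]
    (μ₁ : Measure S₁) (μ₂ : Measure S₂) : Type (max u v + 1) where
  /-- the common space `S` -/
  space : Type (max u v)
  [measurableSpace : MeasurableSpace space]
  /-- the measure of `S` -/
  μ : Measure space
  φ₁ : space → S₁
  φ₂ : space → S₂
  measurePreserving₁ : MeasurePreserving φ₁ μ μ₁
  measurePreserving₂ : MeasurePreserving φ₂ μ μ₂

attribute [instance] Coupling.measurableSpace

/-- `ν` is a coupling measure of `μ₁` and `μ₂`: its marginals are `μ₁` and `μ₂`. -/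
structure IsCouplingMeasure {S₁ : Type u} {S₂ : Type v} [MeasurableSpace S₁] [MeasurableSpace S₂]
    (μ₁ : Measure S₁) (μ₂ : Measure S₂) (ν : Measure (S₁ × S₂)) : Prop where
  map_fst : ν.map Prod.fst = μ₁
  map_snd : ν.map Prod.snd = μ₂

/-- The special coupling given by a coupling measure `ν`: the space is `(S₁ × S₂, ν)` and the two
maps are the projections. -/
def Coupling.special {S₁ : Type u} {S₂ : Type v} [MeasurableSpace S₁] [MeasurableSpace S₂]
    {μ₁ : Measure S₁} {μ₂ : Measure S₂} (ν : Measure (S₁ × S₂))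
    (hν : IsCouplingMeasure μ₁ μ₂ ν) : Coupling μ₁ μ₂ where
  space := S₁ × S₂
  μ := ν
  φ₁ := Prod.fst
  φ₂ := Prod.snd
  measurePreserving₁ := ⟨measurable_fst, hν.map_fst⟩
  measurePreserving₂ := ⟨measurable_snd, hν.map_snd⟩

namespace Graphon

/-- `‖W₁^{φ₁} - W₂^{φ₂}‖_□`, the cut norm (on the space of the coupling) of the difference of the
pull-backs of `W₁` and `W₂` along a coupling `(φ₁, φ₂)`. -/
noncomputable def couplingCutNorm (W₁ : Graphon.{u}) (W₂ : Graphon.{v})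
    (c : Coupling W₁.μ W₂.μ) : ℝ :=
  cutNorm c.μ (fun s t => W₁.W (c.φ₁ s) (c.φ₁ t) - W₂.W (c.φ₂ s) (c.φ₂ t))

/-- The infimum of `‖W₁^{φ₁} - W₂^{φ₂}‖_□` over all couplings `(φ₁, φ₂)`. It is used only for
graphons whose spaces have the same total mass, in which case couplings exist. -/
noncomputable def cutDistOfMassEq (W₁ : Graphon.{u}) (W₂ : Graphon.{v}) : ℝ :=
  ⨅ c : Coupling W₁.μ W₂.μ, couplingCutNorm W₁ W₂ c

/-- `W'` is a trivial extension of `W`: the measure space of `W` is (identified by `ι` with) a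
measurable subspace of that of `W'`, and `W'` extends `W` by `0`. -/
def IsTrivialExtension (W W' : Graphon.{u}) : Prop :=
  ∃ ι : W.space → W'.space, MeasurableEmbedding ι ∧ W'.μ.comap ι = W.μ ∧
    (∀ x y, W'.W (ι x) (ι y) = W.W x y) ∧
    ∀ x y, ¬ (x ∈ range ι ∧ y ∈ range ι) → W'.W x y = 0

/-- The measure on the disjoint union `S ⊔ [0, ∞)` given by `μ` on `S` and by Lebesgue measure
on `[0, ∞)`. -/
noncomputable def halfLineMeasure (W : Graphon.{u}) : Measure (W.space ⊕ Ici (0 : ℝ)) :=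
  W.μ.map Sum.inl + ((volume : Measure ℝ).comap ((↑) : Ici (0 : ℝ) → ℝ)).map Sum.inr

/-- The extension of `W` by `0` to the disjoint union `S ⊔ [0, ∞)`. -/
def halfLineFun (W : Graphon.{u}) : W.space ⊕ Ici (0 : ℝ) → W.space ⊕ Ici (0 : ℝ) → ℝ
  | Sum.inl x, Sum.inl y => W.W x y
  | _, _ => 0

theorem measurableEmbedding_inl' (α β : Type*) [MeasurableSpace α] [MeasurableSpace β] :
    MeasurableEmbedding (Sum.inl : α → α ⊕ β) :=
  ⟨Sum.inl_injective, measurable_inl, fun _ hs => MeasurableSet.inl_image hs⟩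

theorem measurableEmbedding_inr' (α β : Type*) [MeasurableSpace α] [MeasurableSpace β] :
    MeasurableEmbedding (Sum.inr : β → α ⊕ β) :=
  ⟨Sum.inr_injective, measurable_inr, fun _ hs => MeasurableSet.inr_image hs⟩

instance (W : Graphon.{u}) : SigmaFinite W.halfLineMeasure := by
  have h0 : SigmaFinite ((volume : Measure ℝ).comap ((↑) : Ici (0 : ℝ) → ℝ)) := by
    have e := MeasurableEmbedding.subtype_coe (measurableSet_Ici (a := (0 : ℝ)))
    refine SigmaFinite.of_map _ e.measurable.aemeasurable ?_
    rw [e.map_comap]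
    infer_instance
  have h1 := (measurableEmbedding_inl' W.space (Ici (0 : ℝ))).sigmaFinite_map (μ := W.μ)
  have h2 := (measurableEmbedding_inr' W.space (Ici (0 : ℝ))).sigmaFinite_map
    (μ := (volume : Measure ℝ).comap ((↑) : Ici (0 : ℝ) → ℝ))
  unfold halfLineMeasure
  infer_instance

theorem restrict_halfLineMeasure (W : Graphon.{u}) :
    W.halfLineMeasure.restrict (range Sum.inl) = W.μ.map Sum.inl := by
  have e1 := measurableEmbedding_inl' W.space (Ici (0 : ℝ))
  have e2 := measurableEmbedding_inr' W.space (Ici (0 : ℝ))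
  rw [halfLineMeasure, Measure.restrict_add, e1.restrict_map, e2.restrict_map]
  simp

theorem integrable_halfLineFun (W : Graphon.{u}) :
    Integrable (fun z : (W.space ⊕ Ici (0 : ℝ)) × (W.space ⊕ Ici (0 : ℝ)) =>
      W.halfLineFun z.1 z.2) (W.halfLineMeasure.prod W.halfLineMeasure) := by
  have e := measurableEmbedding_inl' W.space (Ici (0 : ℝ))
  have hs : SigmaFinite (W.μ.map (Sum.inl : W.space → W.space ⊕ Ici (0 : ℝ))) :=
    e.sigmaFinite_map
  rw [← integrableOn_iff_integrable_of_support_subset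
    (s := range Sum.inl ×ˢ range Sum.inl), IntegrableOn, ← Measure.prod_restrict,
    restrict_halfLineMeasure, Measure.map_prod_map _ _ measurable_inl measurable_inl,
    (e.prodMap e).integrable_map_iff]
  · exact W.integrable
  · rintro ⟨x | x, y | y⟩ h <;> simp [halfLineFun] at h ⊢

/-- The trivial extension of `W` to `S ⊔ [0, ∞)`, a space of infinite total mass. -/
noncomputable def addHalfLine (W : Graphon.{u}) : Graphon.{u} where
  space := W.space ⊕ Ici (0 : ℝ)
  μ := W.halfLineMeasure
  W := W.halfLineFun
  symm := by
    rintro (x | x) (y | y)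
    · exact W.symm x y
    all_goals rfl
  integrable := W.integrable_halfLineFun

/-- The extension used in the definition of the cut metric is a trivial extension. -/
theorem isTrivialExtension_addHalfLine (W : Graphon.{u}) :
    IsTrivialExtension W W.addHalfLine := by
  have e := measurableEmbedding_inl' W.space (Ici (0 : ℝ))
  refine ⟨Sum.inl, e, ?_, fun x y => rfl, ?_⟩
  · change W.halfLineMeasure.comap Sum.inl = W.μ
    have h := e.comap_restrict W.halfLineMeasure (range Sum.inl)
    rw [restrict_halfLineMeasure, e.comap_map, preimage_range, Measure.restrict_univ] at h
    exact h.symm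
  · rintro (x | x) (y | y) h
    · exact absurd ⟨⟨x, rfl⟩, ⟨y, rfl⟩⟩ h
    all_goals rfl

/-- After the extension used in the definition of the cut metric, the total mass is infinite. -/
theorem addHalfLine_mass (W : Graphon.{u}) : W.addHalfLine.μ univ = ∞ := by
  have h : ((volume : Measure ℝ).comap ((↑) : Ici (0 : ℝ) → ℝ)) univ = ∞ := by
    rw [(MeasurableEmbedding.subtype_coe measurableSet_Ici).comap_apply,
      image_univ, Subtype.range_coe, Real.volume_Ici]
  change (W.μ.map Sum.inl + _ : Measure (W.space ⊕ Ici (0 : ℝ))) univ = ∞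
  rw [Measure.add_apply, Measure.map_apply measurable_inr MeasurableSet.univ, preimage_univ, h]
  simp

open Classical in
/-- The cut metric `δ_□(W₁, W₂)`.  If the two spaces have the same total mass, it is the infimum of
`‖W₁^{φ₁} - W₂^{φ₂}‖_□` over all couplings.  In general one first takes trivial extensions to spaces
of equal total mass; the value does not depend on the choice, and here each space is extended by a
half-line `[0, ∞)`. -/
noncomputable def cutDist (W₁ : Graphon.{u}) (W₂ : Graphon.{v}) : ℝ :=
  if W₁.μ univ = W₂.μ univ then cutDistOfMassEq W₁ W₂
  else cutDistOfMassEq W₁.addHalfLine W₂.addHalfLine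

end Graphon

/-! ### Cut norms: test functions instead of sets, and invariance under push-forward. -/

section CutNorm

variable {S : Type*} [MeasurableSpace S] {μ : Measure S} {F G : S → S → ℝ}

/-! The infimum is attained by compactness, once mass that escapes to infinity is given a place to
go; trivial extensions are what pays for that mass.

Both spaces are embedded in the compact square `X = [0,1]²` so that the first coordinate `w` is
positive on the images and integrable for the transported measures `m₁`, `m₂`. Points with `w = 0`
serve as points at infinity. The kernels vanish on the added part of a trivial extension, so only
the pairs matter in which at least one point is not added. Sending added points to infinity
therefore turns any coupling of trivial extensions into a measure on `X × X`, a partial coupling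
(`IsPartialCoupling`), with the same cut norm (`exists_isPartialCoupling`). Conversely, each partial
coupling comes from a special coupling of trivial extensions (`exists_trivialExtension_special`).

Partial couplings may be infinite, but the integral of `w(x) + w(y)` is the same for all of them.
Weighting by this function and normalizing gives probability measures on the compact space `X × X`,
so a minimizing sequence has a weak limit point. The marginal conditions survive the limit because
they can be tested against `w² f` with `f` continuous, and `w(x)² / (w(x) + w(y))` is continuous
even where both weights vanish. The cut norm is lower semicontinuous because its test functions may
be taken continuous and the kernels are `L¹`-close to `w(x)² w(y)² H(x, y)` with `H` continuous,
uniformly over all partial couplings. Hence a minimizer exists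
(`exists_isPartialCoupling_minimizer`).

It remains to compare the minimum with `cutDist W₁ W₂`. For infinite masses, a partial coupling is
approximated by true couplings: the mass matched with infinity is matched instead with points of
tiny weight, which are available in infinite amount and barely affect the kernels
(`exists_isCouplingMeasure_cutNorm_le`). For equal finite masses the weight is constantly 1 and the
minimization is confined to a closed set on which nothing is at infinity. Unequal masses reduce to
infinite ones by adjoining half-lines. -/

theorem abs_setIntegral_le_integral_abs {α : Type*} [MeasurableSpace α] {ν : Measure α} {f : α → ℝ}
    (hf : Integrable f ν) (s : Set α) : |∫ z in s, f z ∂ν| ≤ ∫ z, |f z| ∂ν :=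
  (abs_integral_le_integral_abs).trans
    (setIntegral_le_integral hf.abs (ae_of_all _ fun _ => abs_nonneg _))

theorem bddAbove_cutNorm (hF : Integrable (fun z : S × S => F z.1 z.2) (μ.prod μ)) :
    BddAbove {r : ℝ | ∃ T U : Set S, MeasurableSet T ∧ MeasurableSet U ∧
      r = |∫ z in T ×ˢ U, F z.1 z.2 ∂(μ.prod μ)|} := by
  refine ⟨∫ z, |F z.1 z.2| ∂(μ.prod μ), ?_⟩
  rintro _ ⟨T, U, -, -, rfl⟩
  exact abs_setIntegral_le_integral_abs hF _

theorem abs_setIntegral_le_cutNorm (hF : Integrable (fun z : S × S => F z.1 z.2) (μ.prod μ))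
    {T U : Set S} (hT : MeasurableSet T) (hU : MeasurableSet U) :
    |∫ z in T ×ˢ U, F z.1 z.2 ∂(μ.prod μ)| ≤ cutNorm μ F :=
  le_csSup (bddAbove_cutNorm hF) ⟨T, U, hT, hU, rfl⟩

theorem cutNorm_le {C : ℝ} (h : ∀ T U : Set S, MeasurableSet T → MeasurableSet U →
    |∫ z in T ×ˢ U, F z.1 z.2 ∂(μ.prod μ)| ≤ C) : cutNorm μ F ≤ C := by
  refine csSup_le ⟨_, ∅, ∅, .empty, .empty, rfl⟩ ?_
  rintro _ ⟨T, U, hT, hU, rfl⟩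
  exact h T U hT hU

theorem cutNorm_nonneg (μ : Measure S) (F : S → S → ℝ) : 0 ≤ cutNorm μ F := by
  refine Real.sSup_nonneg ?_
  rintro _ ⟨T, U, -, -, rfl⟩
  exact abs_nonneg _

theorem cutNorm_le_add (hF : Integrable (fun z : S × S => F z.1 z.2) (μ.prod μ))
    (hG : Integrable (fun z : S × S => G z.1 z.2) (μ.prod μ)) :
    cutNorm μ F ≤ cutNorm μ G + ∫ z : S × S, |F z.1 z.2 - G z.1 z.2| ∂(μ.prod μ) := by
  refine cutNorm_le fun T U hT hU => ?_
  have h1 : ∫ z in T ×ˢ U, F z.1 z.2 ∂(μ.prod μ) = (∫ z in T ×ˢ U, G z.1 z.2 ∂(μ.prod μ)) +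
      ∫ z in T ×ˢ U, (F z.1 z.2 - G z.1 z.2) ∂(μ.prod μ) := by
    rw [integral_sub hF.integrableOn hG.integrableOn]; ring
  rw [h1]
  exact (abs_add_le _ _).trans (add_le_add (abs_setIntegral_le_cutNorm hG hT hU)
    (abs_setIntegral_le_integral_abs (hF.sub hG) _))

theorem cutNorm_restrict [SFinite μ] {D : Set S}
    (h : ∀ x y, ¬ (x ∈ D ∧ y ∈ D) → F x y = 0) : cutNorm (μ.restrict D) F = cutNorm μ F := by
  have key : ∀ T U : Set S, MeasurableSet T → MeasurableSet U →
      ∫ z in T ×ˢ U, F z.1 z.2 ∂((μ.restrict D).prod (μ.restrict D)) =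
      ∫ z in T ×ˢ U, F z.1 z.2 ∂(μ.prod μ) := by
    intro T U hT hU
    rw [Measure.prod_restrict, Measure.restrict_restrict (hT.prod hU)]
    refine (setIntegral_eq_of_subset_of_forall_sdiff_eq_zero (hT.prod hU) inter_subset_left ?_).symm
    rintro z ⟨hz, hz'⟩
    exact h _ _ fun hh => hz' ⟨hz, hh⟩
  unfold cutNorm
  congr 1
  ext r
  constructor
  · rintro ⟨T, U, hT, hU, rfl⟩
    exact ⟨T, U, hT, hU, by rw [key T U hT hU]⟩
  · rintro ⟨T, U, hT, hU, rfl⟩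
    exact ⟨T, U, hT, hU, by rw [key T U hT hU]⟩

/-- A linear functional on `[0,1]`-valued functions is largest at the indicator of the set where its
density `G` is non-negative. The same `T` serves for all `f`. -/
theorem exists_integral_mul_le_setIntegral {ν : Measure S} {G : S → ℝ} (hG : Integrable G ν) :
    ∃ T : Set S, MeasurableSet T ∧ ∀ f : S → ℝ, Measurable f → (∀ x, 0 ≤ f x) → (∀ x, f x ≤ 1) →
      ∫ x, f x * G x ∂ν ≤ ∫ x in T, G x ∂ν := by
  -- `G` is only a.e. measurable, so the set is cut out by a measurable representative.
  obtain ⟨g, hgm, hg⟩ := hG.aestronglyMeasurable.aemeasurable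
  refine ⟨{x | 0 ≤ g x}, measurableSet_le measurable_const hgm, fun f hf h0 h1 => ?_⟩
  rw [← integral_indicator (measurableSet_le measurable_const hgm)]
  refine integral_mono_ae ?_ (hG.indicator (measurableSet_le measurable_const hgm)) ?_
  · refine hG.bdd_mul (c := 1) hf.aestronglyMeasurable (ae_of_all _ fun x => ?_)
    rw [Real.norm_eq_abs, abs_of_nonneg (h0 x)]
    exact h1 x
  · filter_upwards [hg] with x hx
    by_cases hp : 0 ≤ g x
    · rw [indicator_of_mem (by exact hp)]
      nlinarith [h1 x, h0 x]
    · rw [indicator_of_notMem (by exact hp)]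
      nlinarith [h1 x, h0 x]

theorem integrable_mul_mul [SFinite μ]
    (hF : Integrable (fun z : S × S => F z.1 z.2) (μ.prod μ))
    {f g : S → ℝ} (hf : Measurable f) (hg : Measurable g) (f0 : ∀ x, 0 ≤ f x) (f1 : ∀ x, f x ≤ 1)
    (g0 : ∀ x, 0 ≤ g x) (g1 : ∀ x, g x ≤ 1) :
    Integrable (fun z : S × S => f z.1 * g z.2 * F z.1 z.2) (μ.prod μ) := by
  refine hF.bdd_mul (c := 1) ((hf.comp measurable_fst).mul
    (hg.comp measurable_snd)).aestronglyMeasurable (ae_of_all _ fun z => ?_)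
  simp only [Real.norm_eq_abs]
  rw [abs_of_nonneg (mul_nonneg (f0 _) (g0 _))]
  exact mul_le_one₀ (f1 _) (g0 _) (g1 _)

/-- The integral is linear in `f` and in `g` separately: with `g` fixed, `f` can be replaced by the
indicator of a set `T`, and then, with `T` fixed, `g` by that of a set `U`, without decreasing it.
-/
theorem integral_mul_mul_le_cutNorm [SFinite μ]
    (hF : Integrable (fun z : S × S => F z.1 z.2) (μ.prod μ))
    {f g : S → ℝ} (hf : Measurable f) (hg : Measurable g) (f0 : ∀ x, 0 ≤ f x) (f1 : ∀ x, f x ≤ 1)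
    (g0 : ∀ x, 0 ≤ g x) (g1 : ∀ x, g x ≤ 1) :
    ∫ z : S × S, f z.1 * g z.2 * F z.1 z.2 ∂(μ.prod μ) ≤ cutNorm μ F := by
  have hgF := integrable_mul_mul hF (f := fun _ => 1) measurable_const hg
    (fun _ => zero_le_one) (fun _ => le_rfl) g0 g1
  simp only [one_mul] at hgF
  obtain ⟨T, hT, hT'⟩ := exists_integral_mul_le_setIntegral hgF.integral_prod_left
  have hFT : Integrable (fun z : S × S => F z.1 z.2) ((μ.restrict T).prod μ) := by
    have := hF.integrableOn (s := T ×ˢ univ)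
    rwa [IntegrableOn, ← Measure.prod_restrict, Measure.restrict_univ] at this
  have hgFT : Integrable (fun z : S × S => g z.2 * F z.1 z.2) ((μ.restrict T).prod μ) := by
    have := hgF.integrableOn (s := T ×ˢ univ)
    rwa [IntegrableOn, ← Measure.prod_restrict, Measure.restrict_univ] at this
  obtain ⟨U, hU, hU'⟩ := exists_integral_mul_le_setIntegral hFT.integral_prod_right
  calc ∫ z : S × S, f z.1 * g z.2 * F z.1 z.2 ∂(μ.prod μ)
      = ∫ x, f x * ∫ y, g y * F x y ∂μ ∂μ := by
        rw [integral_prod _ (integrable_mul_mul hF hf hg f0 f1 g0 g1)]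
        simp only [mul_assoc, integral_const_mul]
    _ ≤ ∫ x in T, ∫ y, g y * F x y ∂μ ∂μ := hT' f hf f0 f1
    _ = ∫ y, g y * ∫ x in T, F x y ∂μ ∂μ := by
        rw [← integral_prod _ hgFT, integral_prod_symm _ hgFT]
        simp only [integral_const_mul]
    _ ≤ ∫ y in U, ∫ x in T, F x y ∂μ ∂μ := hU' g hg g0 g1
    _ = ∫ z in T ×ˢ U, F z.1 z.2 ∂(μ.prod μ) := by
        rw [← Measure.prod_restrict, integral_prod_symm]
        rw [Measure.prod_restrict]
        exact hF.integrableOn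
    _ ≤ cutNorm μ F := (le_abs_self _).trans (abs_setIntegral_le_cutNorm hF hT hU)

theorem cutNorm_neg (μ : Measure S) (F : S → S → ℝ) :
    cutNorm μ (fun x y => - F x y) = cutNorm μ F := by
  simp only [cutNorm, integral_neg, abs_neg]

theorem abs_integral_mul_mul_le_cutNorm [SFinite μ]
    (hF : Integrable (fun z : S × S => F z.1 z.2) (μ.prod μ))
    {f g : S → ℝ} (hf : Measurable f) (hg : Measurable g) (f0 : ∀ x, 0 ≤ f x) (f1 : ∀ x, f x ≤ 1)
    (g0 : ∀ x, 0 ≤ g x) (g1 : ∀ x, g x ≤ 1) :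
    |∫ z : S × S, f z.1 * g z.2 * F z.1 z.2 ∂(μ.prod μ)| ≤ cutNorm μ F := by
  refine abs_le'.2 ⟨integral_mul_mul_le_cutNorm hF hf hg f0 f1 g0 g1, ?_⟩
  have := integral_mul_mul_le_cutNorm (F := fun x y => - F x y) hF.neg hf hg f0 f1 g0 g1
  rw [cutNorm_neg] at this
  simpa only [mul_neg, integral_neg] using this

/-- A measure dominated by a `σ`-finite measure has a density with values in `[0, 1]`. -/
theorem exists_density_of_le [SigmaFinite μ] {τ : Measure S} (h : τ ≤ μ) :
    ∃ f : S → NNReal, Measurable f ∧ (∀ x, f x ≤ 1) ∧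
      τ = μ.withDensity (fun x => (f x : ℝ≥0∞)) := by
  have : SigmaFinite τ := Measure.sigmaFinite_of_le μ h
  refine ⟨fun x => (min (τ.rnDeriv μ x) 1).toNNReal,
    ((Measure.measurable_rnDeriv τ μ).min measurable_const).ennreal_toNNReal, fun x => ?_, ?_⟩
  · exact (ENNReal.toNNReal_mono ENNReal.one_ne_top (min_le_right _ _)).trans (by simp)
  · conv_lhs => rw [← Measure.withDensity_rnDeriv_eq τ μ (Measure.absolutelyContinuous_of_le h)]
    refine withDensity_congr_ae ?_
    filter_upwards [Measure.rnDeriv_le_one_of_le h] with x hx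
    rw [ENNReal.coe_toNNReal (ne_top_of_le_ne_top ENNReal.one_ne_top (min_le_right _ _)),
      min_eq_left (by exact hx)]

/-- Measures below `μ` have `[0,1]`-valued densities, so they are no stronger as tests than
measurable sets. -/
theorem abs_integral_prod_le_cutNorm [SigmaFinite μ]
    (hF : Integrable (fun z : S × S => F z.1 z.2) (μ.prod μ)) {τ σ : Measure S}
    (hτ : τ ≤ μ) (hσ : σ ≤ μ) : |∫ z : S × S, F z.1 z.2 ∂(τ.prod σ)| ≤ cutNorm μ F := by
  obtain ⟨f, hf, f1, rfl⟩ := exists_density_of_le hτ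
  obtain ⟨g, hg, g1, rfl⟩ := exists_density_of_le hσ
  rw [prod_withDensity hf.coe_nnreal_ennreal hg.coe_nnreal_ennreal]
  have : (fun z : S × S => (f z.1 : ℝ≥0∞) * g z.2) = fun z => ((f z.1 * g z.2 : NNReal) : ℝ≥0∞) := by
    ext z; simp
  rw [this, integral_withDensity_eq_integral_smul
    (by fun_prop : Measurable fun z : S × S => f z.1 * g z.2)]
  simp only [NNReal.smul_def, smul_eq_mul, NNReal.coe_mul]
  exact abs_integral_mul_mul_le_cutNorm hF hf.coe_nnreal_real hg.coe_nnreal_real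
    (fun x => (f x).2) (fun x => f1 x) (fun x => (g x).2) (fun x => g1 x)

/-- Sets in `S` pull back to sets in `R`, which gives one inequality. In the other direction, the
image of `ρ` restricted to `T` need not be a restriction of `ρ.map ψ`, but it is dominated by it,
and that suffices by `abs_integral_prod_le_cutNorm`. -/
theorem cutNorm_map {R : Type*} [MeasurableSpace R] {ρ : Measure R} {ψ : R → S} (hψ : Measurable ψ)
    [SigmaFinite (ρ.map ψ)]
    (hF : Integrable (fun z : S × S => F z.1 z.2) ((ρ.map ψ).prod (ρ.map ψ))) :
    cutNorm (ρ.map ψ) F = cutNorm ρ (fun x y => F (ψ x) (ψ y)) := by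
  have : SigmaFinite ρ := SigmaFinite.of_map _ hψ.aemeasurable inferInstance
  have hle : ∀ T : Set R, (ρ.restrict T).map ψ ≤ ρ.map ψ := fun T =>
    Measure.map_mono Measure.restrict_le_self hψ
  have key : ∀ T U : Set R,
      ∫ z in T ×ˢ U, F (ψ z.1) (ψ z.2) ∂(ρ.prod ρ) =
      ∫ z, F z.1 z.2 ∂(((ρ.restrict T).map ψ).prod ((ρ.restrict U).map ψ)) := by
    intro T U
    have : SigmaFinite ((ρ.restrict T).map ψ) := Measure.sigmaFinite_of_le _ (hle T)
    have : SigmaFinite ((ρ.restrict U).map ψ) := Measure.sigmaFinite_of_le _ (hle U)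
    rw [Measure.map_prod_map _ _ hψ hψ, integral_map (hψ.prodMap hψ).aemeasurable,
      Measure.prod_restrict]
    · rfl
    rw [← Measure.map_prod_map _ _ hψ hψ]
    exact hF.aestronglyMeasurable.mono_measure (Measure.prod_mono (hle T) (hle U))
  refine le_antisymm (cutNorm_le fun T U hT hU => ?_) (cutNorm_le fun T U hT hU => ?_)
  · rw [← Measure.prod_restrict, Measure.restrict_map hψ hT, Measure.restrict_map hψ hU, ← key]
    refine abs_setIntegral_le_cutNorm (F := fun x y => F (ψ x) (ψ y)) ?_ (hψ hT) (hψ hU)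
    rw [Measure.map_prod_map _ _ hψ hψ] at hF
    exact (integrable_map_measure hF.aestronglyMeasurable (hψ.prodMap hψ).aemeasurable).1 hF
  · rw [key]
    exact abs_integral_prod_le_cutNorm hF (hle T) (hle U)

end CutNorm

/-! ### Pull-backs of kernels, partial couplings and weighted kernels. -/

section Pullback

variable {R X : Type*} [MeasurableSpace R] [MeasurableSpace X] {m : Measure R} {μ : Measure X}
  {A : Set R} {g : R → X} {H : X → X → ℝ}

/-- Only the part of `m` on `A` is known to map to `μ`; the pulled-back kernel vanishes off `A × A`,
so the rest of `m` is invisible to it. -/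
theorem integrable_pullback [SigmaFinite m] (hg : Measurable g) (hm : (m.restrict A).map g = μ) [SigmaFinite μ]
    (h0 : ∀ s t, ¬ (s ∈ A ∧ t ∈ A) → H (g s) (g t) = 0)
    (hH : Integrable (fun z : X × X => H z.1 z.2) (μ.prod μ)) :
    Integrable (fun z : R × R => H (g z.1) (g z.2)) (m.prod m) := by
  rw [← integrableOn_iff_integrable_of_support_subset (s := A ×ˢ A), IntegrableOn,
    ← Measure.prod_restrict]
  · subst hm
    rw [Measure.map_prod_map _ _ hg hg] at hH
    exact (integrable_map_measure hH.aestronglyMeasurable (hg.prodMap hg).aemeasurable).1 hH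
  · intro z hz
    by_contra h
    exact hz (h0 _ _ h)

theorem integral_pullback [SigmaFinite m]
    (hg : Measurable g) (hm : (m.restrict A).map g = μ) [SigmaFinite μ]
    (h0 : ∀ s t, ¬ (s ∈ A ∧ t ∈ A) → H (g s) (g t) = 0)
    (hH : AEStronglyMeasurable (fun z : X × X => H z.1 z.2) (μ.prod μ)) :
    ∫ z : R × R, H (g z.1) (g z.2) ∂(m.prod m) = ∫ z : X × X, H z.1 z.2 ∂(μ.prod μ) := by
  rw [← setIntegral_eq_integral_of_forall_compl_eq_zero (s := A ×ˢ A), ← Measure.prod_restrict]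
  · subst hm
    rw [Measure.map_prod_map _ _ hg hg] at hH ⊢
    rw [integral_map (hg.prodMap hg).aemeasurable hH]
    rfl
  · intro z h
    exact h0 _ _ h

end Pullback

/-- A partial coupling of two measures on a space with weight `w`: a measure `m` on `X × X` whose
marginals agree with `m₁` and `m₂` away from the zero set of the weight, which plays the role of
a set of points at infinity. -/
structure IsPartialCoupling {X : Type*} [MeasurableSpace X] (w : X → ℝ) (m₁ m₂ : Measure X)
    (m : Measure (X × X)) : Prop where
  zero : m {p | w p.1 = 0 ∧ w p.2 = 0} = 0
  fst : (m.restrict {p | w p.1 ≠ 0}).map Prod.fst = m₁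
  snd : (m.restrict {p | w p.2 ≠ 0}).map Prod.snd = m₂

/-- A kernel on a weighted space: an integrable function that vanishes on the zero set of the
weight. -/
structure IsWeightedKernel {X : Type*} [MeasurableSpace X] (w : X → ℝ) (m : Measure X)
    (V : X → X → ℝ) : Prop where
  integrable : Integrable (fun z : X × X => V z.1 z.2) (m.prod m)
  left : ∀ x y, w x = 0 → V x y = 0
  right : ∀ x y, w y = 0 → V x y = 0

/-- The function `V₁(x₁, y₁) - V₂(x₂, y₂)` on `(X × X) × (X × X)`. -/
def diffKernel {X : Type*} (V₁ V₂ : X → X → ℝ) : X × X → X × X → ℝ :=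
  fun s t => V₁ s.1 t.1 - V₂ s.2 t.2

section PartialCoupling

variable {X : Type*} [MeasurableSpace X] {w : X → ℝ} {m₁ m₂ : Measure X} {m : Measure (X × X)}
  {V V₁ V₂ : X → X → ℝ}

theorem IsWeightedKernel.eq_zero (hV : IsWeightedKernel w m₁ V) {x y : X}
    (h : ¬ (w x ≠ 0 ∧ w y ≠ 0)) : V x y = 0 := by
  by_cases hx : w x = 0
  · exact hV.left _ _ hx
  · exact hV.right _ _ (by_contra fun hy => h ⟨hx, hy⟩)

theorem IsWeightedKernel.abs_sub {V' : X → X → ℝ} (hV : IsWeightedKernel w m₁ V)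
    (hV' : IsWeightedKernel w m₁ V') : IsWeightedKernel w m₁ fun x y => |V x y - V' x y| :=
  ⟨(hV.integrable.sub hV'.integrable).abs, fun x y h => by simp [hV.left x y h, hV'.left x y h],
    fun x y h => by simp [hV.right x y h, hV'.right x y h]⟩

theorem measurableSet_weight_ne (hw : Measurable w) : MeasurableSet {x | w x ≠ 0} :=
  (hw (measurableSet_singleton 0)).compl

theorem measurableSet_weight_ne_fst (hw : Measurable w) :
    MeasurableSet {p : X × X | w p.1 ≠ 0} :=
  measurable_fst (measurableSet_weight_ne hw)

theorem measurableSet_weight_ne_snd (hw : Measurable w) :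
    MeasurableSet {p : X × X | w p.2 ≠ 0} :=
  measurable_snd (measurableSet_weight_ne hw)

theorem measurableSet_weight_eq (hw : Measurable w) : MeasurableSet {x | w x = 0} :=
  hw (measurableSet_singleton 0)

namespace IsPartialCoupling

theorem ae_ne (h : IsPartialCoupling w m₁ m₂ m) : ∀ᵐ p ∂m, w p.1 ≠ 0 ∨ w p.2 ≠ 0 := by
  rw [ae_iff]
  simpa only [not_or, not_not] using h.zero

/-- Almost every point has a coordinate of non-zero weight, and on each of the two corresponding
sets a projection has σ-finite image. -/
theorem sigmaFinite (h : IsPartialCoupling w m₁ m₂ m) [SigmaFinite m₁] [SigmaFinite m₂] :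
    SigmaFinite m := by
  have h1 : SigmaFinite (m.restrict {p | w p.1 ≠ 0}) :=
    SigmaFinite.of_map _ measurable_fst.aemeasurable (by rw [h.fst]; infer_instance)
  have h2 : SigmaFinite (m.restrict {p | w p.2 ≠ 0}) :=
    SigmaFinite.of_map _ measurable_snd.aemeasurable (by rw [h.snd]; infer_instance)
  have h3 : m = m.restrict ({p | w p.1 ≠ 0} ∪ {p | w p.2 ≠ 0}) :=
    (Measure.restrict_eq_self_of_ae_mem h.ae_ne).symm
  rw [h3]
  exact Measure.sigmaFinite_of_le _ (Measure.restrict_union_le _ _)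

variable [SigmaFinite m₁] [SigmaFinite m₂]

theorem integrable_fst (h : IsPartialCoupling w m₁ m₂ m)
    (hV : IsWeightedKernel w m₁ V) :
    Integrable (fun z : (X × X) × (X × X) => V z.1.1 z.2.1) (m.prod m) := by
  have := h.sigmaFinite
  exact integrable_pullback (g := Prod.fst) (A := {p : X × X | w p.1 ≠ 0}) (H := V)
    measurable_fst h.fst (fun s t hst => hV.eq_zero hst) hV.integrable

theorem integrable_snd (h : IsPartialCoupling w m₁ m₂ m)
    (hV : IsWeightedKernel w m₂ V) :
    Integrable (fun z : (X × X) × (X × X) => V z.1.2 z.2.2) (m.prod m) := by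
  have := h.sigmaFinite
  exact integrable_pullback (g := Prod.snd) (A := {p : X × X | w p.2 ≠ 0}) (H := V)
    measurable_snd h.snd (fun s t hst => hV.eq_zero hst) hV.integrable

theorem integral_fst (h : IsPartialCoupling w m₁ m₂ m)
    (hV : IsWeightedKernel w m₁ V) :
    ∫ z : (X × X) × (X × X), V z.1.1 z.2.1 ∂(m.prod m) = ∫ z, V z.1 z.2 ∂(m₁.prod m₁) := by
  have := h.sigmaFinite
  exact integral_pullback (g := Prod.fst) (A := {p : X × X | w p.1 ≠ 0}) (H := V) measurable_fst h.fst
    (fun s t hst => hV.eq_zero hst) hV.integrable.aestronglyMeasurable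

theorem integral_snd (h : IsPartialCoupling w m₁ m₂ m)
    (hV : IsWeightedKernel w m₂ V) :
    ∫ z : (X × X) × (X × X), V z.1.2 z.2.2 ∂(m.prod m) = ∫ z, V z.1 z.2 ∂(m₂.prod m₂) := by
  have := h.sigmaFinite
  exact integral_pullback (g := Prod.snd) (A := {p : X × X | w p.2 ≠ 0}) (H := V) measurable_snd h.snd
    (fun s t hst => hV.eq_zero hst) hV.integrable.aestronglyMeasurable

theorem integrable_diffKernel (h : IsPartialCoupling w m₁ m₂ m)
    (h₁ : IsWeightedKernel w m₁ V₁) (h₂ : IsWeightedKernel w m₂ V₂) :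
    Integrable (fun z : (X × X) × (X × X) => diffKernel V₁ V₂ z.1 z.2) (m.prod m) :=
  (h.integrable_fst h₁).sub (h.integrable_snd h₂)

/-- The integral of the absolute difference of two difference kernels is controlled by the `L¹`
distances of the kernels. -/
theorem integral_abs_diffKernel_sub_le {V₁' V₂' : X → X → ℝ} (h : IsPartialCoupling w m₁ m₂ m)
    (h₁ : IsWeightedKernel w m₁ V₁) (h₂ : IsWeightedKernel w m₂ V₂)
    (h₁' : IsWeightedKernel w m₁ V₁') (h₂' : IsWeightedKernel w m₂ V₂') :
    ∫ z : (X × X) × (X × X), |diffKernel V₁ V₂ z.1 z.2 - diffKernel V₁' V₂' z.1 z.2| ∂(m.prod m) ≤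
      (∫ z, |V₁ z.1 z.2 - V₁' z.1 z.2| ∂(m₁.prod m₁)) +
        ∫ z, |V₂ z.1 z.2 - V₂' z.1 z.2| ∂(m₂.prod m₂) := by
  have e₁ := h₁.abs_sub h₁'
  have e₂ := h₂.abs_sub h₂'
  rw [← h.integral_fst e₁, ← h.integral_snd e₂,
    ← integral_add (h.integrable_fst e₁) (h.integrable_snd e₂)]
  refine integral_mono ((h.integrable_diffKernel h₁ h₂).sub
    (h.integrable_diffKernel h₁' h₂')).abs
    ((h.integrable_fst e₁).add (h.integrable_snd e₂)) fun z => ?_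
  simp only [diffKernel]
  rw [show ∀ a b c d : ℝ, a - b - (c - d) = (a - c) - (b - d) by intros; ring]
  exact abs_sub _ _

/-- The error depends on the kernels and the marginals but not on `m`. This uniformity lets kernels
be approximated before a limit of partial couplings is taken. -/
theorem cutNorm_le_add {V₁' V₂' : X → X → ℝ} (h : IsPartialCoupling w m₁ m₂ m)
    (h₁ : IsWeightedKernel w m₁ V₁) (h₂ : IsWeightedKernel w m₂ V₂)
    (h₁' : IsWeightedKernel w m₁ V₁') (h₂' : IsWeightedKernel w m₂ V₂') :
    cutNorm m (diffKernel V₁ V₂) ≤ cutNorm m (diffKernel V₁' V₂') +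
      ((∫ z, |V₁ z.1 z.2 - V₁' z.1 z.2| ∂(m₁.prod m₁)) +
        ∫ z, |V₂ z.1 z.2 - V₂' z.1 z.2| ∂(m₂.prod m₂)) :=
  (_root_.cutNorm_le_add (h.integrable_diffKernel h₁ h₂)
    (h.integrable_diffKernel h₁' h₂')).trans
    (add_le_add le_rfl (h.integral_abs_diffKernel_sub_le h₁ h₂ h₁' h₂'))

end IsPartialCoupling

end PartialCoupling

/-! ### Multiplying and dividing measures by a weight. -/

section WeightedDensity

variable {Y : Type*} [MeasurableSpace Y] {μ : Measure Y} {a : Y → ℝ}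

theorem integral_withDensity_ofReal (ha : Measurable a) (h0 : ∀ x, 0 ≤ a x) (φ : Y → ℝ) :
    ∫ x, φ x ∂(μ.withDensity fun x => ENNReal.ofReal (a x)) = ∫ x, a x * φ x ∂μ := by
  have := integral_withDensity_eq_integral_smul (μ := μ) ha.real_toNNReal φ
  simp only [NNReal.smul_def, smul_eq_mul, Real.coe_toNNReal _ (h0 _)] at this
  exact this

theorem integrable_withDensity_ofReal (ha : Measurable a) (h0 : ∀ x, 0 ≤ a x) {φ : Y → ℝ} :
    Integrable φ (μ.withDensity fun x => ENNReal.ofReal (a x)) ↔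
      Integrable (fun x => a x * φ x) μ := by
  have := integrable_withDensity_iff_integrable_smul (μ := μ) ha.real_toNNReal (g := φ)
  simp only [NNReal.smul_def, smul_eq_mul, Real.coe_toNNReal _ (h0 _)] at this
  exact this

theorem prod_withDensity_ofReal [SFinite μ] (ha : Measurable a) (h0 : ∀ x, 0 ≤ a x) :
    (μ.withDensity fun x => ENNReal.ofReal (a x)).prod
      (μ.withDensity fun x => ENNReal.ofReal (a x)) =
    (μ.prod μ).withDensity fun z => ENNReal.ofReal (a z.1 * a z.2) := by
  rw [prod_withDensity (by fun_prop) (by fun_prop)]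
  congr 1
  ext z
  rw [ENNReal.ofReal_mul (h0 _)]

theorem integral_prod_withDensity_ofReal [SFinite μ] (ha : Measurable a) (h0 : ∀ x, 0 ≤ a x)
    (Φ : Y × Y → ℝ) :
    ∫ z, Φ z ∂((μ.withDensity fun x => ENNReal.ofReal (a x)).prod
      (μ.withDensity fun x => ENNReal.ofReal (a x))) =
    ∫ z : Y × Y, a z.1 * a z.2 * Φ z ∂(μ.prod μ) := by
  rw [prod_withDensity_ofReal ha h0, integral_withDensity_ofReal (by fun_prop)
    fun z => mul_nonneg (h0 _) (h0 _)]

theorem integrable_prod_withDensity_ofReal [SFinite μ] (ha : Measurable a) (h0 : ∀ x, 0 ≤ a x)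
    {Φ : Y × Y → ℝ} :
    Integrable Φ ((μ.withDensity fun x => ENNReal.ofReal (a x)).prod
      (μ.withDensity fun x => ENNReal.ofReal (a x))) ↔
    Integrable (fun z : Y × Y => a z.1 * a z.2 * Φ z) (μ.prod μ) := by
  rw [prod_withDensity_ofReal ha h0, integrable_withDensity_ofReal (by fun_prop)
    fun z => mul_nonneg (h0 _) (h0 _)]

theorem withDensity_ofReal_inj {ν : Measure Y} (ha : Measurable a)
    (h0 : ∀ x, 0 ≤ a x) (hμ : μ {x | a x = 0} = 0) (hν : ν {x | a x = 0} = 0)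
    (h : (μ.withDensity fun x => ENNReal.ofReal (a x)) =
      ν.withDensity fun x => ENNReal.ofReal (a x)) : μ = ν := by
  have key : ∀ ρ : Measure Y, ρ {x | a x = 0} = 0 →
      (ρ.withDensity fun x => ENNReal.ofReal (a x)).withDensity
        (fun x => ENNReal.ofReal (a x))⁻¹ = ρ := by
    intro ρ hρ
    refine withDensity_inv_same ha.ennreal_ofReal ?_ (ae_of_all _ fun x => ENNReal.ofReal_ne_top)
    rw [ae_iff]
    refine measure_mono_null (fun x hx => ?_) hρ
    simp only [ne_eq, not_not, mem_ofPred_eq, ENNReal.ofReal_eq_zero] at hx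
    exact le_antisymm hx (h0 x)
  rw [← key μ hμ, ← key ν hν, h]

/-- The measure with density `c / ω` with respect to `P`, where `1 / 0` is read as `0`. -/
noncomputable def divWeight (c : NNReal) (ω : Y → ℝ) (P : Measure Y) : Measure Y :=
  (c • P).withDensity fun x => ENNReal.ofReal (ω x)⁻¹

instance (c : NNReal) (ω : Y → ℝ) (P : Measure Y) [IsFiniteMeasure P] :
    SigmaFinite (divWeight c ω P) :=
  SigmaFinite.withDensity_ofReal _

theorem divWeight_absolutelyContinuous (c : NNReal) (ω : Y → ℝ) (P : Measure Y) :
    divWeight c ω P ≪ P :=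
  (withDensity_absolutelyContinuous _ _).trans Measure.smul_absolutelyContinuous

theorem divWeight_zero (c : NNReal) {ω : Y → ℝ} (hω : Measurable ω) (P : Measure Y) :
    divWeight c ω P {x | ω x = 0} = 0 := by
  have hm : MeasurableSet {x | ω x = 0} := hω (measurableSet_singleton 0)
  rw [divWeight, withDensity_apply _ hm]
  refine (setLIntegral_congr_fun hm fun x hx => ?_).trans (lintegral_zero)
  have : ω x = 0 := hx
  simp [this]

theorem integral_divWeight (c : NNReal) {ω : Y → ℝ} (hω : Measurable ω) (h0 : ∀ x, 0 ≤ ω x)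
    (P : Measure Y) (φ : Y → ℝ) :
    ∫ x, φ x ∂(divWeight c ω P) = c * ∫ x, (ω x)⁻¹ * φ x ∂P := by
  rw [divWeight, integral_withDensity_ofReal (by fun_prop : Measurable fun x => (ω x)⁻¹) fun x => inv_nonneg.2 (h0 x),
    integral_smul_nnreal_measure]
  rfl

theorem integral_prod_divWeight (c : NNReal) {ω : Y → ℝ} (hω : Measurable ω) (h0 : ∀ x, 0 ≤ ω x)
    (P : Measure Y) [IsFiniteMeasure P] (Φ : Y × Y → ℝ) :
    ∫ z, Φ z ∂((divWeight c ω P).prod (divWeight c ω P)) =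
      c * (c * ∫ z : Y × Y, (ω z.1)⁻¹ * (ω z.2)⁻¹ * Φ z ∂(P.prod P)) := by
  rw [divWeight, integral_prod_withDensity_ofReal (by fun_prop : Measurable fun x => (ω x)⁻¹)
    fun x => inv_nonneg.2 (h0 x)]
  have : (c • P).prod (c • P) = c • (c • P.prod P) := by
    rw [Measure.prod_smul_left, Measure.prod_smul_right]
  rw [this, integral_smul_nnreal_measure, integral_smul_nnreal_measure]
  rfl

/-- A measure that gives finite non-zero total mass to the weight `ω` arises from a probability
measure. -/
theorem exists_eq_divWeight {m : Measure Y} {ω : Y → ℝ} {c : NNReal} (hω : Measurable ω)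
    (h0 : ∀ x, 0 ≤ ω x) (hm : m {x | ω x = 0} = 0) (hc : c ≠ 0)
    (hmc : ∫⁻ x, ENNReal.ofReal (ω x) ∂m = c) :
    ∃ P : ProbabilityMeasure Y, (P : Measure Y) ≪ m ∧ m = divWeight c ω P := by
  let Q : Measure Y := c⁻¹ • m.withDensity fun x => ENNReal.ofReal (ω x)
  have hQ : IsProbabilityMeasure Q := by
    constructor
    simp only [Q, Measure.smul_apply, withDensity_apply _ MeasurableSet.univ, Measure.restrict_univ,
      hmc]
    rw [ENNReal.smul_def, smul_eq_mul, ← ENNReal.coe_mul, inv_mul_cancel₀ hc, ENNReal.coe_one]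
  refine ⟨⟨Q, hQ⟩, Measure.smul_absolutelyContinuous.trans (withDensity_absolutelyContinuous _ _), ?_⟩
  have : c • Q = m.withDensity fun x => ENNReal.ofReal (ω x) := by
    simp only [Q, smul_smul, mul_inv_cancel₀ hc, one_smul]
  simp only [divWeight, ProbabilityMeasure.coe_mk, this]
  have hae : ∀ᵐ x ∂m, ω x ≠ 0 := by rw [ae_iff]; simpa using hm
  refine Eq.trans ?_ (withDensity_congr_ae (g := fun x => ENNReal.ofReal (ω x)⁻¹)
    (f := (fun x => ENNReal.ofReal (ω x))⁻¹) ?_)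
  · refine (withDensity_inv_same hω.ennreal_ofReal ?_
      (ae_of_all _ fun x => ENNReal.ofReal_ne_top)).symm
    filter_upwards [hae] with x hx
    simpa using lt_of_le_of_ne (h0 x) (Ne.symm hx)
  · filter_upwards [(withDensity_absolutelyContinuous m _).ae_le hae] with x hx
    rw [Pi.inv_apply, ENNReal.ofReal_inv_of_pos (lt_of_le_of_ne (h0 x) (Ne.symm hx))]

end WeightedDensity

/-! ### Approximation by continuous test functions and continuous kernels. -/

section Approximation

open Filter Topology BoundedContinuousFunction

/-- The indicator function of a measurable set is an a.e. limit of continuous functions with values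
in `[0, 1]`. -/
theorem exists_seq_continuous_tendsto_indicator {Y : Type*} [TopologicalSpace Y] [NormalSpace Y]
    [MeasurableSpace Y] [BorelSpace Y] (P : Measure Y) [IsFiniteMeasure P] [P.WeaklyRegular]
    {T : Set Y} (hT : MeasurableSet T) :
    ∃ f : ℕ → Y → ℝ, (∀ n, Continuous (f n)) ∧ (∀ n x, 0 ≤ f n x) ∧ (∀ n x, f n x ≤ 1) ∧
      ∀ᵐ x ∂P, Tendsto (fun n => f n x) atTop (𝓝 (T.indicator 1 x)) := by
  have hi : MemLp (T.indicator (1 : Y → ℝ)) 1 P :=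
    (memLp_indicator_const 1 hT (1 : ℝ) (Or.inr (measure_ne_top _ _)))
  have h1 : ∀ n : ℕ, ∃ g : Y →ᵇ ℝ, eLpNorm (T.indicator (1 : Y → ℝ) - ⇑g) 1 P ≤ (2⁻¹ : ℝ≥0∞) ^ n ∧
      MemLp g 1 P := fun n =>
    hi.exists_boundedContinuous_eLpNorm_sub_le ENNReal.one_ne_top (by simp)
  choose g hg hgm using h1
  have hlim : Tendsto (fun n => eLpNorm (⇑(g n) - T.indicator (1 : Y → ℝ)) 1 P) atTop (𝓝 0) := by
    refine tendsto_of_tendsto_of_tendsto_of_le_of_le tendsto_const_nhds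
      (ENNReal.tendsto_pow_atTop_nhds_zero_of_lt_one (r := 2⁻¹) (by simp)) (fun _ => zero_le)
      fun n => ?_
    rw [eLpNorm_sub_comm]
    exact hg n
  obtain ⟨ns, -, hns⟩ := (tendstoInMeasure_of_tendsto_eLpNorm one_ne_zero
    (fun n => (hgm n).aestronglyMeasurable) hi.aestronglyMeasurable hlim).exists_seq_tendsto_ae
  -- Clipping to `[0,1]` is continuous and fixes the values 0 and 1, so it does not disturb the
  -- limit.
  refine ⟨fun n x => max 0 (min 1 (g (ns n) x)), fun n => by fun_prop, fun n x => le_max_left _ _,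
    fun n x => max_le zero_le_one (min_le_left _ _), ?_⟩
  filter_upwards [hns] with x hx
  have : T.indicator (1 : Y → ℝ) x = max 0 (min 1 (T.indicator (1 : Y → ℝ) x)) := by
    by_cases h : x ∈ T <;> simp [h]
  rw [this]
  exact tendsto_const_nhds.max (tendsto_const_nhds.min hx)

/-- Indicators are approximated almost everywhere for the finite measure `P`, hence for `m ≪ P`,
which may be infinite; integrability of `F` then gives dominated convergence. -/
theorem cutNorm_le_of_continuous {Y : Type*} [TopologicalSpace Y] [NormalSpace Y]
    [MeasurableSpace Y] [BorelSpace Y] {P m : Measure Y} [IsFiniteMeasure P] [P.WeaklyRegular]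
    [SigmaFinite m] (hm : m ≪ P) {F : Y → Y → ℝ}
    (hF : Integrable (fun z : Y × Y => F z.1 z.2) (m.prod m)) {C : ℝ}
    (h : ∀ f g : Y → ℝ, Continuous f → Continuous g → (∀ x, 0 ≤ f x) → (∀ x, f x ≤ 1) →
      (∀ x, 0 ≤ g x) → (∀ x, g x ≤ 1) →
      |∫ z : Y × Y, f z.1 * g z.2 * F z.1 z.2 ∂(m.prod m)| ≤ C) :
    cutNorm m F ≤ C := by
  refine cutNorm_le fun T U hT hU => ?_
  obtain ⟨f, hfc, f0, f1, hf⟩ := exists_seq_continuous_tendsto_indicator P hT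
  obtain ⟨g, hgc, g0, g1, hg⟩ := exists_seq_continuous_tendsto_indicator P hU
  have hlim : Tendsto (fun n => ∫ z : Y × Y, f n z.1 * g n z.2 * F z.1 z.2 ∂(m.prod m)) atTop
      (𝓝 (∫ z : Y × Y, T.indicator 1 z.1 * U.indicator 1 z.2 * F z.1 z.2 ∂(m.prod m))) := by
    refine tendsto_integral_of_dominated_convergence (fun z => ‖F z.1 z.2‖) (fun n => ?_) hF.norm
      (fun n => ae_of_all _ fun z => ?_) ?_
    · exact (integrable_mul_mul hF (hfc n).measurable (hgc n).measurable (f0 n) (f1 n) (g0 n)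
        (g1 n)).aestronglyMeasurable
    · rw [norm_mul, Real.norm_eq_abs, abs_of_nonneg (mul_nonneg (f0 _ _) (g0 _ _))]
      exact mul_le_of_le_one_left (norm_nonneg _) (mul_le_one₀ (f1 _ _) (g0 _ _) (g1 _ _))
    · filter_upwards [Measure.quasiMeasurePreserving_fst.ae (hm.ae_le hf),
        Measure.quasiMeasurePreserving_snd.ae (hm.ae_le hg)] with z h1 h2
      exact (h1.mul h2).mul tendsto_const_nhds
  have heq : ∫ z in T ×ˢ U, F z.1 z.2 ∂(m.prod m) =
      ∫ z : Y × Y, T.indicator 1 z.1 * U.indicator 1 z.2 * F z.1 z.2 ∂(m.prod m) := by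
    rw [← integral_indicator (hT.prod hU)]
    refine integral_congr_ae (ae_of_all _ fun z => ?_)
    by_cases h1 : z.1 ∈ T <;> by_cases h2 : z.2 ∈ U <;> simp [h1, h2, Set.indicator]
  rw [heq]
  exact le_of_tendsto hlim.abs (Eventually.of_forall fun n =>
    h _ _ (hfc n) (hgc n) (f0 n) (f1 n) (g0 n) (g1 n))

/-- The squared weights are there so that the kernel remains continuous on `(X × X) × (X × X)` after
division by the pair weights of both arguments. -/
theorem IsWeightedKernel.of_continuous {X : Type*} [TopologicalSpace X] [CompactSpace X]
    [SecondCountableTopology X] [MeasurableSpace X] [BorelSpace X] {w : X → ℝ} {m : Measure X}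
    [SFinite m] (hm : Integrable (fun x => w x ^ 2) m) {H : X × X → ℝ}
    (hH : Continuous H) :
    IsWeightedKernel w m fun x y => w x ^ 2 * w y ^ 2 * H (x, y) := by
  refine ⟨?_, fun x y h => by simp [h], fun x y h => by simp [h]⟩
  obtain ⟨K, hK⟩ := (isCompact_range hH).isBounded.exists_norm_le
  exact (hm.mul_prod hm).mul_bdd (c := K) hH.measurable.aestronglyMeasurable
    (ae_of_all _ fun z => hK _ ⟨_, rfl⟩)

/-- Weighted kernels are approximated in `L¹` by continuous ones. -/
theorem IsWeightedKernel.exists_continuous_approx {X : Type*} [TopologicalSpace X] [CompactSpace X]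
    [SecondCountableTopology X] [TopologicalSpace.PseudoMetrizableSpace X] [MeasurableSpace X]
    [BorelSpace X] {w : X → ℝ} {m : Measure X} [SFinite m] (hw : Measurable w)
    (hm : Integrable (fun x => w x ^ 2) m) {V : X → X → ℝ} (hV : IsWeightedKernel w m V)
    {ε : ℝ} (hε : 0 < ε) : ∃ H : X × X → ℝ, Continuous H ∧
      ∫ z : X × X, |V z.1 z.2 - w z.1 ^ 2 * w z.2 ^ 2 * H z| ∂(m.prod m) ≤ ε := by
  have hw2 : Measurable fun x => w x ^ 2 := hw.pow_const 2
  have h0 : ∀ x, 0 ≤ w x ^ 2 := fun x => sq_nonneg _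
  -- Dividing `V` by `w(x)² w(y)²` is an isometry onto `L¹(q × q)` for such kernels, and bounded
  -- continuous functions are dense there because `q` is finite.
  let q := m.withDensity fun x => ENNReal.ofReal (w x ^ 2)
  have : IsFiniteMeasure q := isFiniteMeasure_withDensity_ofReal hm.2
  have hV' : ∀ z : X × X, w z.1 ^ 2 * w z.2 ^ 2 * ((w z.1 ^ 2 * w z.2 ^ 2)⁻¹ * V z.1 z.2) =
      V z.1 z.2 := by
    intro z
    by_cases h : w z.1 ≠ 0 ∧ w z.2 ≠ 0
    · have := h.1
      have := h.2
      field_simp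
    · rw [hV.eq_zero h]; simp
  have hint : Integrable (fun z : X × X => (w z.1 ^ 2 * w z.2 ^ 2)⁻¹ * V z.1 z.2) (q.prod q) := by
    rw [integrable_prod_withDensity_ofReal hw2 h0]
    simp only [hV']
    exact hV.integrable
  obtain ⟨H, hH, -⟩ := hint.exists_boundedContinuous_integral_sub_le hε
  refine ⟨H, H.continuous, ?_⟩
  rw [integral_prod_withDensity_ofReal hw2 h0] at hH
  refine le_trans (le_of_eq (integral_congr_ae (ae_of_all _ fun z => ?_))) hH
  simp only [Real.norm_eq_abs]
  rw [← abs_of_nonneg (mul_nonneg (h0 z.1) (h0 z.2)), ← abs_mul, mul_sub]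
  rw [abs_of_nonneg (mul_nonneg (h0 z.1) (h0 z.2)), hV']

/-- At a zero of `ω` the quotient takes the value 0, since `0⁻¹ = 0`, and nearby it is squeezed by
`|b|`, which tends to 0. -/
theorem continuous_inv_mul_of_le {Y : Type*} [TopologicalSpace Y] {ω a b : Y → ℝ}
    (hω : Continuous ω) (ha : Continuous a) (hb : Continuous b) (h : ∀ x, |a x| ≤ ω x * b x)
    (hb0 : ∀ x, ω x = 0 → b x = 0) (hω0 : ∀ x, 0 ≤ ω x) : Continuous fun x => (ω x)⁻¹ * a x := by
  rw [continuous_iff_continuousAt]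
  intro x
  by_cases hx : ω x = 0
  · have : (ω x)⁻¹ * a x = 0 := by simp [hx]
    rw [ContinuousAt, this]
    refine squeeze_zero_norm (a := fun y => |b y|) (fun y => ?_) ?_
    · rw [norm_mul, norm_inv, Real.norm_eq_abs, Real.norm_eq_abs, abs_of_nonneg (hω0 y)]
      by_cases hy : ω y = 0
      · simp [hy]
      · rw [inv_mul_le_iff₀ (lt_of_le_of_ne (hω0 y) (Ne.symm hy))]
        exact (h y).trans (mul_le_mul_of_nonneg_left (le_abs_self _) (hω0 y))
    · have := (continuous_abs.comp hb).tendsto x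
      simpa [Function.comp_def, hb0 x hx] using this
  · exact (hω.continuousAt.inv₀ hx).mul ha.continuousAt

end Approximation

/-! ### Marginals of partial couplings, and weak limits of weighted measures. -/

section Compactness

open Filter Topology

namespace IsPartialCoupling

section Marginals

variable {X : Type*} [MeasurableSpace X] {w : X → ℝ} {m₁ m₂ : Measure X} {m : Measure (X × X)}

/-- Pairs whose first point is at infinity do not contribute, since `φ` vanishes there. -/
theorem lintegral_fst (h : IsPartialCoupling w m₁ m₂ m) (hw : Measurable w) {φ : X → ℝ≥0∞}
    (hφ : Measurable φ) (h0 : ∀ x, w x = 0 → φ x = 0) :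
    ∫⁻ p, φ p.1 ∂m = ∫⁻ x, φ x ∂m₁ := by
  rw [← h.fst, lintegral_map hφ measurable_fst,
    ← lintegral_indicator (measurableSet_weight_ne_fst hw)]
  refine lintegral_congr fun p => ?_
  by_cases hp : w p.1 = 0 <;> simp [hp, h0, indicator]

theorem lintegral_snd (h : IsPartialCoupling w m₁ m₂ m) (hw : Measurable w) {φ : X → ℝ≥0∞}
    (hφ : Measurable φ) (h0 : ∀ x, w x = 0 → φ x = 0) :
    ∫⁻ p, φ p.2 ∂m = ∫⁻ x, φ x ∂m₂ := by
  rw [← h.snd, lintegral_map hφ measurable_snd,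
    ← lintegral_indicator (measurableSet_weight_ne_snd hw)]
  refine lintegral_congr fun p => ?_
  by_cases hp : w p.2 = 0 <;> simp [hp, h0, indicator]

theorem measure_fst_zero (h : IsPartialCoupling w m₁ m₂ m) (hw : Measurable w) :
    m₁ {x | w x = 0} = 0 := by
  rw [← h.fst, Measure.map_apply measurable_fst (measurableSet_weight_eq hw),
    Measure.restrict_apply (measurable_fst (measurableSet_weight_eq hw))]
  convert measure_empty (μ := m)
  ext p
  simp

theorem measure_snd_zero (h : IsPartialCoupling w m₁ m₂ m) (hw : Measurable w) :
    m₂ {x | w x = 0} = 0 := by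
  rw [← h.snd, Measure.map_apply measurable_snd (measurableSet_weight_eq hw),
    Measure.restrict_apply (measurable_snd (measurableSet_weight_eq hw))]
  convert measure_empty (μ := m)
  ext p
  simp

/-- The total weight of a partial coupling is determined by its marginals. -/
theorem lintegral_weight (h : IsPartialCoupling w m₁ m₂ m) (hw : Measurable w) (h0 : ∀ x, 0 ≤ w x) :
    ∫⁻ p : X × X, ENNReal.ofReal (w p.1 + w p.2) ∂m =
      ∫⁻ x, ENNReal.ofReal (w x) ∂m₁ + ∫⁻ x, ENNReal.ofReal (w x) ∂m₂ := by
  rw [← h.lintegral_fst hw hw.ennreal_ofReal fun x hx => by simp [hx],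
    ← h.lintegral_snd hw hw.ennreal_ofReal fun x hx => by simp [hx],
    ← lintegral_add_left (by fun_prop)]
  simp only [ENNReal.ofReal_add (h0 _) (h0 _)]

end Marginals

end IsPartialCoupling

variable {Y : Type*} [MetricSpace Y] [CompactSpace Y] [MeasurableSpace Y] [BorelSpace Y]
  {ι : Type*} {l : Filter ι} {P : ι → ProbabilityMeasure Y} {P₀ : ProbabilityMeasure Y}

theorem tendsto_integral_probabilityMeasure (hP : Tendsto P l (𝓝 P₀)) {φ : Y → ℝ}
    (hφ : Continuous φ) :
    Tendsto (fun i => ∫ y, φ y ∂(P i : Measure Y)) l (𝓝 (∫ y, φ y ∂(P₀ : Measure Y))) :=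
  ProbabilityMeasure.tendsto_iff_forall_integral_tendsto.1 hP
    (BoundedContinuousFunction.mkOfCompact ⟨φ, hφ⟩)

theorem tendsto_integral_divWeight (c : NNReal) {ω : Y → ℝ} (hω : Measurable ω)
    (h0 : ∀ x, 0 ≤ ω x) (hP : Tendsto P l (𝓝 P₀)) {φ : Y → ℝ}
    (hφ : Continuous fun y => (ω y)⁻¹ * φ y) :
    Tendsto (fun i => ∫ y, φ y ∂(divWeight c ω (P i))) l
      (𝓝 (∫ y, φ y ∂(divWeight c ω P₀))) := by
  simp only [integral_divWeight c hω h0]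
  exact (tendsto_integral_probabilityMeasure hP hφ).const_mul _

theorem tendsto_integral_prod_divWeight (c : NNReal) {ω : Y → ℝ} (hω : Measurable ω)
    (h0 : ∀ x, 0 ≤ ω x) (hP : Tendsto P l (𝓝 P₀)) {Φ : Y × Y → ℝ}
    (hΦ : Continuous fun z : Y × Y => (ω z.1)⁻¹ * (ω z.2)⁻¹ * Φ z) :
    Tendsto (fun i => ∫ z, Φ z ∂((divWeight c ω (P i)).prod (divWeight c ω (P i)))) l
      (𝓝 (∫ z, Φ z ∂((divWeight c ω P₀).prod (divWeight c ω P₀)))) := by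
  simp only [integral_prod_divWeight c hω h0]
  have h2 : Tendsto (fun i => (P i).prod (P i)) l (𝓝 (P₀.prod P₀)) :=
    (ProbabilityMeasure.continuous_prod.tendsto (P₀, P₀)).comp (hP.prodMk_nhds hP)
  exact ((tendsto_integral_probabilityMeasure h2 hΦ).const_mul _).const_mul _

omit [CompactSpace Y] in
-- By the portmanteau inequality for the open set `Kᶜ`, the limit `P₀` does not charge it either.
theorem divWeight_compl_eq_zero_of_tendsto [l.NeBot] (c : NNReal) {ω : Y → ℝ}
    (hP : Tendsto P l (𝓝 P₀)) {K : Set Y} (hK : IsClosed K)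
    (h : ∀ i, (P i : Measure Y) Kᶜ = 0) : divWeight c ω P₀ Kᶜ = 0 := by
  refine divWeight_absolutelyContinuous c ω _ (le_antisymm ?_ zero_le)
  have := ProbabilityMeasure.le_liminf_measure_open_of_tendsto hP hK.isOpen_compl
  simpa only [h, liminf_const] using this

end Compactness

/-! ### Existence of a minimizing partial coupling. -/

section Minimizer

open Filter Topology

variable {X : Type*} [MetricSpace X] [CompactSpace X] [MeasurableSpace X] [BorelSpace X]
  {w : X → ℝ} {m₁ m₂ : Measure X}

/-- The weight `w(x) + w(y)` on `X × X`. -/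
def pairWeight (w : X → ℝ) (p : X × X) : ℝ := w p.1 + w p.2

omit [MetricSpace X] [CompactSpace X] [MeasurableSpace X] [BorelSpace X] in
theorem pairWeight_eq_zero (h0 : ∀ x, 0 ≤ w x) {p : X × X} :
    pairWeight w p = 0 ↔ w p.1 = 0 ∧ w p.2 = 0 :=
  add_eq_zero_iff_of_nonneg (h0 _) (h0 _)

omit [CompactSpace X] [MeasurableSpace X] [BorelSpace X] in
theorem continuous_pairWeight (hw : Continuous w) : Continuous (pairWeight w) := by
  unfold pairWeight
  fun_prop

omit [CompactSpace X] [MeasurableSpace X] [BorelSpace X] in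
-- The quotient is at most `w p.1`, so it tends to 0 where both weights vanish. The first power `w
-- p.1` over the pair weight would in general have no limit there, which is why squares of the
-- weight are used throughout.
theorem continuous_inv_pairWeight_mul_fst (hw : Continuous w) (h0 : ∀ x, 0 ≤ w x) :
    Continuous fun p : X × X => (pairWeight w p)⁻¹ * w p.1 ^ 2 := by
  refine continuous_inv_mul_of_le (b := fun p => w p.1) (continuous_pairWeight hw) (by fun_prop)
    (by fun_prop) (fun p => ?_) (fun p hp => ((pairWeight_eq_zero h0).1 hp).1)
    fun p => add_nonneg (h0 _) (h0 _)
  rw [abs_of_nonneg (sq_nonneg _), pairWeight]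
  nlinarith [h0 p.1, h0 p.2, mul_nonneg (h0 p.1) (h0 p.2)]

omit [CompactSpace X] [MeasurableSpace X] [BorelSpace X] in
theorem continuous_inv_pairWeight_mul_snd (hw : Continuous w) (h0 : ∀ x, 0 ≤ w x) :
    Continuous fun p : X × X => (pairWeight w p)⁻¹ * w p.2 ^ 2 := by
  refine continuous_inv_mul_of_le (b := fun p => w p.2) (continuous_pairWeight hw) (by fun_prop)
    (by fun_prop) (fun p => ?_) (fun p hp => ((pairWeight_eq_zero h0).1 hp).2)
    fun p => add_nonneg (h0 _) (h0 _)
  rw [abs_of_nonneg (sq_nonneg _), pairWeight]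
  nlinarith [h0 p.1, h0 p.2, mul_nonneg (h0 p.1) (h0 p.2)]

omit [MetricSpace X] [CompactSpace X] [BorelSpace X] in
theorem integral_map_restrict_mul {m : Measure (X × X)} {g : X × X → X} (hg : Measurable g)
    (hw : Measurable w) {f : X → ℝ} (hf : Measurable f) :
    ∫ x, w x ^ 2 * f x ∂((m.restrict {p | w (g p) ≠ 0}).map g) =
      ∫ p, w (g p) ^ 2 * f (g p) ∂m := by
  rw [integral_map hg.aemeasurable (by fun_prop)]
  refine setIntegral_eq_integral_of_forall_compl_eq_zero fun p hp => ?_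
  have : w (g p) = 0 := by simpa using hp
  simp [this]

theorem integrable_sq_of_compact (hw : Continuous w) {m : Measure X}
    (hm : Integrable w m) : Integrable (fun x => w x ^ 2) m := by
  obtain ⟨K, hK⟩ := (isCompact_range hw).isBounded.exists_norm_le
  simp only [sq]
  exact hm.mul_bdd (c := K) hw.measurable.aestronglyMeasurable (ae_of_all _ fun z => hK _ ⟨_, rfl⟩)

variable {ι : Type*} {l : Filter ι} [l.NeBot] {P : ι → ProbabilityMeasure (X × X)}
  {P₀ : ProbabilityMeasure (X × X)} {c : NNReal}

/-- Multiplied by `w²`, both sides become finite measures, so continuous test functions `f` suffice.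
The integrand `w(g p)² f(g p)` is continuous after division by the pair weight, so its integrals
converge; along the family they are constant. -/
theorem map_restrict_divWeight_of_tendsto (hw : Continuous w) (h0 : ∀ x, 0 ≤ w x) {μ : Measure X}
    (hμ : Integrable w μ) (hμ0 : μ {x | w x = 0} = 0) {g : X × X → X} (hg : Continuous g)
    (hgw : Continuous fun p => (pairWeight w p)⁻¹ * w (g p) ^ 2)
    (hP : Tendsto P l (𝓝 P₀))
    (h : ∀ i, ((divWeight c (pairWeight w) (P i)).restrict {p | w (g p) ≠ 0}).map g = μ) :
    ((divWeight c (pairWeight w) P₀).restrict {p | w (g p) ≠ 0}).map g = μ := by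
  have hwm := hw.measurable
  have hgm := hg.measurable
  have hωm := (continuous_pairWeight hw).measurable
  have hω0 : ∀ p : X × X, 0 ≤ pairWeight w p := fun p => add_nonneg (h0 _) (h0 _)
  have hw2 : Measurable fun x => w x ^ 2 := hwm.pow_const 2
  have hw20 : ∀ x, 0 ≤ w x ^ 2 := fun x => sq_nonneg _
  have hset : {x | w x ^ 2 = 0} = {x | w x = 0} := by ext x; simp
  refine withDensity_ofReal_inj hw2 hw20 ?_ (by rwa [hset]) ?_
  · rw [hset, Measure.map_apply hgm (measurableSet_weight_eq hwm),
      Measure.restrict_apply (hgm (measurableSet_weight_eq hwm))]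
    convert measure_empty (μ := divWeight c (pairWeight w) (P₀ : Measure (X × X)))
    ext p
    simp
  have hfin1 : IsFiniteMeasure (μ.withDensity fun x => ENNReal.ofReal (w x ^ 2)) :=
    isFiniteMeasure_withDensity_ofReal (integrable_sq_of_compact hw hμ).2
  have hfin2 : IsFiniteMeasure ((((divWeight c (pairWeight w) P₀).restrict
      {p | w (g p) ≠ 0}).map g).withDensity fun x => ENNReal.ofReal (w x ^ 2)) := by
    refine isFiniteMeasure_withDensity_ofReal (Integrable.hasFiniteIntegral ?_)
    rw [integrable_map_measure hw2.aestronglyMeasurable hgm.aemeasurable]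
    refine Integrable.mono_measure ?_ Measure.restrict_le_self
    rw [divWeight, integrable_withDensity_ofReal (by fun_prop) fun p => inv_nonneg.2 (hω0 p)]
    exact hgw.integrable_of_hasCompactSupport (HasCompactSupport.of_compactSpace _)
  refine ext_of_forall_integral_eq_of_IsFiniteMeasure fun f => ?_
  have hf := f.continuous
  rw [integral_withDensity_ofReal hw2 hw20, integral_withDensity_ofReal hw2 hw20,
    integral_map_restrict_mul hgm hwm hf.measurable]
  have hlim := tendsto_integral_divWeight c hωm hω0 hP (φ := fun p => w (g p) ^ 2 * f (g p)) (by
    simp only [← mul_assoc]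
    exact hgw.mul (hf.comp hg))
  refine tendsto_nhds_unique hlim (tendsto_const_nhds.congr fun i => ?_)
  rw [← h i, integral_map_restrict_mul hgm hwm hf.measurable]

/-- The set of partial couplings is closed under limits of the weighted measures. -/
theorem isPartialCoupling_divWeight_of_tendsto (hw : Continuous w) (h0 : ∀ x, 0 ≤ w x)
    (hm₁ : Integrable w m₁) (hm₂ : Integrable w m₂) (hP : Tendsto P l (𝓝 P₀))
    (h : ∀ i, IsPartialCoupling w m₁ m₂ (divWeight c (pairWeight w) (P i))) :
    IsPartialCoupling w m₁ m₂ (divWeight c (pairWeight w) P₀) := by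
  obtain ⟨i⟩ : Nonempty ι := nonempty_of_neBot l
  refine ⟨?_, ?_, ?_⟩
  · simp only [← pairWeight_eq_zero h0]
    exact divWeight_zero c (continuous_pairWeight hw).measurable _
  · exact map_restrict_divWeight_of_tendsto hw h0 hm₁ ((h i).measure_fst_zero hw.measurable)
      continuous_fst (continuous_inv_pairWeight_mul_fst hw h0) hP fun i => (h i).fst
  · exact map_restrict_divWeight_of_tendsto hw h0 hm₂ ((h i).measure_snd_zero hw.measurable)
      continuous_snd (continuous_inv_pairWeight_mul_snd hw h0) hP fun i => (h i).snd

variable [SigmaFinite m₁] [SigmaFinite m₂]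

/-- The cut norm of the difference kernel is lower semicontinuous along partial couplings. -/
theorem cutNorm_diffKernel_le_of_tendsto (hw : Continuous w) (h0 : ∀ x, 0 ≤ w x)
    (hm₁ : Integrable w m₁) (hm₂ : Integrable w m₂) (hP : Tendsto P l (𝓝 P₀))
    (h : ∀ i, IsPartialCoupling w m₁ m₂ (divWeight c (pairWeight w) (P i)))
    {V₁ V₂ : X → X → ℝ} (h₁ : IsWeightedKernel w m₁ V₁) (h₂ : IsWeightedKernel w m₂ V₂) {L : ℝ}
    (hL : Tendsto (fun i => cutNorm (divWeight c (pairWeight w) (P i)) (diffKernel V₁ V₂)) l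
      (𝓝 L)) :
    cutNorm (divWeight c (pairWeight w) P₀) (diffKernel V₁ V₂) ≤ L := by
  have hlim := isPartialCoupling_divWeight_of_tendsto hw h0 hm₁ hm₂ hP h
  have hωm := (continuous_pairWeight hw).measurable
  have hω0 : ∀ p : X × X, 0 ≤ pairWeight w p := fun p => add_nonneg (h0 _) (h0 _)
  refine cutNorm_le_of_continuous (divWeight_absolutelyContinuous c _ _)
    (hlim.integrable_diffKernel h₁ h₂) fun f g hf hg f0 f1 g0 g1 => ?_
  -- The budget `ε` is split in half: both kernels are replaced by approximations, at cost `ε / 4`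
  -- each, once along the family and once more at the limit.
  refine le_of_forall_pos_le_add fun ε hε => ?_
  have hm₁' := integrable_sq_of_compact hw hm₁
  have hm₂' := integrable_sq_of_compact hw hm₂
  obtain ⟨H₁, hH₁, happ₁⟩ := h₁.exists_continuous_approx hw.measurable hm₁'
    (show 0 < ε / 4 by positivity)
  obtain ⟨H₂, hH₂, happ₂⟩ := h₂.exists_continuous_approx hw.measurable hm₂'
    (show 0 < ε / 4 by positivity)
  have k₁ := IsWeightedKernel.of_continuous hm₁' hH₁
  have k₂ := IsWeightedKernel.of_continuous hm₂' hH₂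
  set V₁' : X → X → ℝ := fun x y => w x ^ 2 * w y ^ 2 * H₁ (x, y) with hV₁'
  set V₂' : X → X → ℝ := fun x y => w x ^ 2 * w y ^ 2 * H₂ (x, y) with hV₂'
  -- Each inverse pair weight is absorbed by a squared weight of the approximating kernels, leaving
  -- a continuous integrand.
  have hconv := tendsto_integral_prod_divWeight c hωm hω0 hP
    (Φ := fun z => f z.1 * g z.2 * diffKernel V₁' V₂' z.1 z.2) (by
      have c1 := continuous_inv_pairWeight_mul_fst hw h0
      have c2 := continuous_inv_pairWeight_mul_snd hw h0
      have : Continuous fun z : (X × X) × (X × X) => f z.1 * g z.2 *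
        (((pairWeight w z.1)⁻¹ * w z.1.1 ^ 2) * ((pairWeight w z.2)⁻¹ * w z.2.1 ^ 2) *
          H₁ (z.1.1, z.2.1) - ((pairWeight w z.1)⁻¹ * w z.1.2 ^ 2) *
          ((pairWeight w z.2)⁻¹ * w z.2.2 ^ 2) * H₂ (z.1.2, z.2.2)) := by
        have a1 := c1.comp (continuous_fst (X := X × X) (Y := X × X))
        have a2 := c1.comp (continuous_snd (X := X × X) (Y := X × X))
        have b1 := c2.comp (continuous_fst (X := X × X) (Y := X × X))
        have b2 := c2.comp (continuous_snd (X := X × X) (Y := X × X))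
        exact (by fun_prop : Continuous fun z : (X × X) × (X × X) => f z.1 * g z.2).mul
          (((a1.mul a2).mul (by fun_prop : Continuous fun z : (X × X) × (X × X) =>
            H₁ (z.1.1, z.2.1))).sub ((b1.mul b2).mul
            (by fun_prop : Continuous fun z : (X × X) × (X × X) => H₂ (z.1.2, z.2.2))))
      refine this.congr fun z => ?_
      simp only [diffKernel, hV₁', hV₂']
      ring)
  have hbound : ∀ i, |∫ z, f z.1 * g z.2 * diffKernel V₁' V₂' z.1 z.2
      ∂((divWeight c (pairWeight w) (P i : Measure (X × X))).prod
        (divWeight c (pairWeight w) (P i)))| ≤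
      cutNorm (divWeight c (pairWeight w) (P i)) (diffKernel V₁ V₂) + ε / 2 := by
    intro i
    refine (abs_integral_mul_mul_le_cutNorm ((h i).integrable_diffKernel k₁ k₂) hf.measurable
      hg.measurable f0 f1 g0 g1).trans (((h i).cutNorm_le_add k₁ k₂ h₁ h₂).trans ?_)
    have e₁ : ∫ z : X × X, |V₁' z.1 z.2 - V₁ z.1 z.2| ∂(m₁.prod m₁) ≤ ε / 4 := by
      simpa only [abs_sub_comm] using happ₁
    have e₂ : ∫ z : X × X, |V₂' z.1 z.2 - V₂ z.1 z.2| ∂(m₂.prod m₂) ≤ ε / 4 := by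
      simpa only [abs_sub_comm] using happ₂
    linarith
  have hle := le_of_tendsto_of_tendsto' hconv.abs (hL.add_const (ε / 2)) hbound
  have hi := integrable_mul_mul (hlim.integrable_diffKernel h₁ h₂) hf.measurable hg.measurable
    f0 f1 g0 g1
  have hi' := integrable_mul_mul (hlim.integrable_diffKernel k₁ k₂) hf.measurable hg.measurable
    f0 f1 g0 g1
  have hdiff := hlim.integral_abs_diffKernel_sub_le h₁ h₂ k₁ k₂
  have hclose : |(∫ z, f z.1 * g z.2 * diffKernel V₁ V₂ z.1 z.2
      ∂((divWeight c (pairWeight w) (P₀ : Measure (X × X))).prod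
        (divWeight c (pairWeight w) P₀))) -
      ∫ z, f z.1 * g z.2 * diffKernel V₁' V₂' z.1 z.2
      ∂((divWeight c (pairWeight w) (P₀ : Measure (X × X))).prod
        (divWeight c (pairWeight w) P₀))| ≤ ε / 2 := by
    rw [← integral_sub hi hi']
    refine abs_integral_le_integral_abs.trans (le_trans (integral_mono (hi.sub hi').abs
      ((hlim.integrable_diffKernel h₁ h₂).sub (hlim.integrable_diffKernel k₁ k₂)).abs
      fun z => ?_) (hdiff.trans (by linarith)))
    simp only [Pi.sub_apply]
    rw [← mul_sub, abs_mul, abs_of_nonneg (mul_nonneg (f0 _) (g0 _))]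
    exact mul_le_of_le_one_left (abs_nonneg _) (mul_le_one₀ (f1 _) (g0 _) (g1 _))
  have := abs_sub_abs_le_abs_sub (∫ z, f z.1 * g z.2 * diffKernel V₁ V₂ z.1 z.2
      ∂((divWeight c (pairWeight w) (P₀ : Measure (X × X))).prod
        (divWeight c (pairWeight w) P₀))) (∫ z, f z.1 * g z.2 * diffKernel V₁' V₂' z.1 z.2
      ∂((divWeight c (pairWeight w) (P₀ : Measure (X × X))).prod
        (divWeight c (pairWeight w) P₀)))
  linarith

/-- Among the partial couplings supported on a closed set there is one that minimizes the cut norm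
of the difference kernel. -/
theorem exists_isPartialCoupling_minimizer (hw : Continuous w) (h0 : ∀ x, 0 ≤ w x)
    (hm₁ : Integrable w m₁) (hm₂ : Integrable w m₂)
    {V₁ V₂ : X → X → ℝ} (h₁ : IsWeightedKernel w m₁ V₁) (h₂ : IsWeightedKernel w m₂ V₂)
    {K : Set (X × X)} (hK : IsClosed K)
    (hne : ∃ m, IsPartialCoupling w m₁ m₂ m ∧ m Kᶜ = 0) :
    ∃ m, (IsPartialCoupling w m₁ m₂ m ∧ m Kᶜ = 0) ∧
      ∀ m', IsPartialCoupling w m₁ m₂ m' → m' Kᶜ = 0 →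
        cutNorm m (diffKernel V₁ V₂) ≤ cutNorm m' (diffKernel V₁ V₂) := by
  have hωm := (continuous_pairWeight hw).measurable
  have hω0 : ∀ p : X × X, 0 ≤ pairWeight w p := fun p => add_nonneg (h0 _) (h0 _)
  obtain ⟨m₀, hm₀⟩ := hne
  have hCfin : ∫⁻ x, ENNReal.ofReal (w x) ∂m₁ + ∫⁻ x, ENNReal.ofReal (w x) ∂m₂ ≠ ∞ :=
    ENNReal.add_ne_top.2 ⟨hm₁.lintegral_lt_top.ne, hm₂.lintegral_lt_top.ne⟩
  obtain ⟨C, hC⟩ : ∃ C : NNReal, (C : ℝ≥0∞) =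
      ∫⁻ x, ENNReal.ofReal (w x) ∂m₁ + ∫⁻ x, ENNReal.ofReal (w x) ∂m₂ :=
    ⟨_, ENNReal.coe_toNNReal hCfin⟩
  -- All partial couplings have the same total weight `C`; this normalization is what makes
  -- compactness available.
  have hmass : ∀ m, IsPartialCoupling w m₁ m₂ m →
      ∫⁻ p, ENNReal.ofReal (pairWeight w p) ∂m = C := fun m hm => by
    rw [hC]; exact hm.lintegral_weight hw.measurable h0
  have hnull : ∀ m, IsPartialCoupling w m₁ m₂ m → m {p | pairWeight w p = 0} = 0 := fun m hm => by
    simp only [pairWeight_eq_zero h0]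
    exact hm.zero
  -- If `C = 0` there is nothing to normalize, but then the weight, positive almost everywhere,
  -- forces every partial coupling to be 0.
  rcases eq_or_ne C 0 with rfl | hC0
  · have hzero : ∀ m, IsPartialCoupling w m₁ m₂ m → m = 0 := fun m hm => by
      have h1 := hmass m hm
      rw [ENNReal.coe_zero, lintegral_eq_zero_iff hωm.ennreal_ofReal] at h1
      have h2 : ∀ᵐ p ∂m, pairWeight w p ≠ 0 := by
        rw [ae_iff]
        simpa using hnull m hm
      rw [← Measure.measure_univ_eq_zero, ← compl_empty]
      change ∀ᵐ p ∂m, False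
      filter_upwards [h1, h2] with p hp hp'
      simp only [Pi.zero_apply, ENNReal.ofReal_eq_zero] at hp
      exact hp' (le_antisymm hp (hω0 p))
    refine ⟨m₀, hm₀, fun m' hm' _ => ?_⟩
    rw [hzero m₀ hm₀.1, hzero m' hm']
  let A : Set ℝ := {r | ∃ m, IsPartialCoupling w m₁ m₂ m ∧ m Kᶜ = 0 ∧
    r = cutNorm m (diffKernel V₁ V₂)}
  have hAne : A.Nonempty := ⟨_, m₀, hm₀.1, hm₀.2, rfl⟩
  have hAbdd : BddBelow A := ⟨0, by rintro _ ⟨m, -, -, rfl⟩; exact cutNorm_nonneg _ _⟩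
  obtain ⟨r, -, hr, hrA⟩ := exists_seq_tendsto_sInf hAne hAbdd
  choose m hm hmK hmr using hrA
  have hP := fun n => exists_eq_divWeight hωm hω0 (hnull _ (hm n)) hC0 (hmass _ (hm n))
  choose P hPac hP using hP
  -- The probability measures on the compact space `X × X` form a compact space, so the minimizing
  -- sequence converges along an ultrafilter finer than `atTop`.
  let F : Ultrafilter ℕ := Ultrafilter.of atTop
  have hF : (F : Filter ℕ) ≤ atTop := Ultrafilter.of_le _
  obtain ⟨P₀, -, hP₀⟩ := isCompact_univ.ultrafilter_le_nhds (F.map P) (by simp)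
  have hlim : Tendsto P F (𝓝 P₀) := hP₀
  have hPm : ∀ n, IsPartialCoupling w m₁ m₂ (divWeight C (pairWeight w) (P n)) := fun n => by
    rw [← hP n]; exact hm n
  refine ⟨divWeight C (pairWeight w) P₀,
    ⟨isPartialCoupling_divWeight_of_tendsto hw h0 hm₁ hm₂ hlim hPm,
      divWeight_compl_eq_zero_of_tendsto C hlim hK fun n => hPac n (hmK n)⟩, fun m' hm' hm'K => ?_⟩
  refine (cutNorm_diffKernel_le_of_tendsto (L := sInf A) hw h0 hm₁ hm₂ hlim hPm h₁ h₂ ?_).trans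
    (csInf_le hAbdd ⟨m', hm', hm'K, rfl⟩)
  refine (hr.mono_left hF).congr fun n => ?_
  rw [hmr n, ← hP n]

end Minimizer

/-! ### Cutting an infinite measure into pieces of prescribed mass. -/

section Splitting

open Filter Topology

/-- The half-open interval between two consecutive partial sums of `b`. -/
def partialSumIco (b : ℕ → NNReal) (n : ℕ) : Set ℝ :=
  Ico (∑ i ∈ Finset.range n, (b i : ℝ)) (∑ i ∈ Finset.range (n + 1), (b i : ℝ))

theorem volume_partialSumIco (b : ℕ → NNReal) (n : ℕ) : volume (partialSumIco b n) = b n := by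
  rw [partialSumIco, Real.volume_Ico, Finset.sum_range_succ, add_sub_cancel_left,
    ENNReal.ofReal_coe_nnreal]

theorem monotone_partialSum (b : ℕ → NNReal) :
    Monotone fun n => ∑ i ∈ Finset.range n, (b i : ℝ) :=
  monotone_nat_of_le_succ fun n => by
    rw [Finset.sum_range_succ]; exact le_add_of_nonneg_right (b n).2

theorem pairwise_disjoint_partialSumIco (b : ℕ → NNReal) :
    Pairwise (Function.onFun Disjoint (partialSumIco b)) :=
  (monotone_partialSum b).pairwise_disjoint_on_Ico_succ

theorem iUnion_partialSumIco {b : ℕ → NNReal} (hb : ∑' n, (b n : ℝ≥0∞) = ∞) :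
    ⋃ n, partialSumIco b n = Ici 0 := by
  have hlim : Tendsto (fun n => ∑ i ∈ Finset.range n, (b i : ℝ)) atTop atTop := by
    have : ¬ Summable b := fun h => ENNReal.tsum_coe_ne_top_iff_summable.2 h hb
    have := (NNReal.tendsto_coe_atTop.2 (NNReal.not_summable_iff_tendsto_nat_atTop.1 this))
    simpa only [NNReal.coe_sum] using this
  ext x
  simp only [mem_iUnion, mem_Ici]
  constructor
  · rintro ⟨n, hn⟩
    exact (Finset.sum_nonneg fun i _ => (b i).2).trans hn.1
  · intro hx
    have hex : ∃ n, x < ∑ i ∈ Finset.range n, (b i : ℝ) := (hlim.eventually_gt_atTop x).exists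
    classical
    have hpos : Nat.find hex ≠ 0 := fun h => by
      have := Nat.find_spec hex
      rw [h] at this
      simp only [Finset.range_zero, Finset.sum_empty] at this
      linarith
    obtain ⟨k, hk⟩ := Nat.exists_eq_succ_of_ne_zero hpos
    refine ⟨k, not_lt.1 (Nat.find_min hex (by omega)), ?_⟩
    have := Nat.find_spec hex
    rwa [hk] at this

/-- The intervals of `b` tile `[0, ∞)`, because its sum diverges, and so they cut up the interval of
`a`. -/
theorem tsum_volume_inter_partialSumIco (a : ℕ → NNReal) {b : ℕ → NNReal}
    (hb : ∑' n, (b n : ℝ≥0∞) = ∞) (k : ℕ) :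
    ∑' n, volume (partialSumIco a k ∩ partialSumIco b n) = a k := by
  rw [← measure_iUnion, ← inter_iUnion, iUnion_partialSumIco hb, inter_eq_left.2,
    volume_partialSumIco]
  · exact fun x hx => (Finset.sum_nonneg fun i _ => (a i).2).trans hx.1
  · exact fun i j hij => (pairwise_disjoint_partialSumIco b hij).mono inter_subset_right
      inter_subset_right
  · exact fun n => measurableSet_Ico.inter measurableSet_Ico

/-- An infinite s-finite measure is a sum of measures with prescribed masses. -/
theorem exists_sum_eq_of_measure_univ_eq_top {Z : Type*} [MeasurableSpace Z] (ρ : Measure Z)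
    [SFinite ρ] (hρ : ρ univ = ∞) {b : ℕ → NNReal} (hb : ∑' n, (b n : ℝ≥0∞) = ∞) :
    ∃ r : ℕ → Measure Z, (∀ n, r n univ = b n) ∧ Measure.sum r = ρ := by
  let σ := sfiniteSeq ρ
  have hσ : Measure.sum σ = ρ := sum_sfiniteSeq ρ
  let a : ℕ → NNReal := fun k => (σ k univ).toNNReal
  have ha : ∀ k, σ k univ = a k := fun k => (ENNReal.coe_toNNReal (measure_ne_top _ _)).symm
  have hasum : ∑' k, (a k : ℝ≥0∞) = ∞ := by
    simp only [← ha]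
    rw [← hρ, ← hσ, Measure.sum_apply _ MeasurableSet.univ]
  -- The masses `a k` and `b n` are laid out as two tilings of the half-line. The overlap lengths
  -- form a matrix with row sums `a k` and column sums `b n`; the piece `r n` receives the fraction
  -- `c k n / a k` of `σ k`.
  let c : ℕ → ℕ → ℝ≥0∞ := fun k n => volume (partialSumIco a k ∩ partialSumIco b n)
  have hc1 : ∀ k, ∑' n, c k n = a k := tsum_volume_inter_partialSumIco a hb
  have hc2 : ∀ n, ∑' k, c k n = b n := fun n => by
    simp only [c, fun k => inter_comm (partialSumIco a k)]
    exact tsum_volume_inter_partialSumIco b hasum n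
  have hca : ∀ k n, c k n * (a k : ℝ≥0∞)⁻¹ * a k = c k n := by
    intro k n
    by_cases h : a k = 0
    · have : c k n = 0 := le_antisymm ((measure_mono inter_subset_left).trans
        (by rw [volume_partialSumIco, h, ENNReal.coe_zero])) zero_le
      simp [this]
    · rw [mul_assoc, ENNReal.inv_mul_cancel (by simpa using h) ENNReal.coe_ne_top, mul_one]
  refine ⟨fun n => Measure.sum fun k => (c k n * (a k : ℝ≥0∞)⁻¹) • σ k, fun n => ?_, ?_⟩
  · rw [Measure.sum_apply _ MeasurableSet.univ]
    simp only [Measure.smul_apply, smul_eq_mul, ha, hca, hc2]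
  · ext s hs
    simp only [← hσ, Measure.sum_apply _ hs, Measure.smul_apply, smul_eq_mul]
    rw [ENNReal.tsum_comm]
    refine tsum_congr fun k => ?_
    rw [ENNReal.tsum_mul_right, ENNReal.tsum_mul_right, hc1]
    by_cases h : a k = 0
    · have : σ k s = 0 := measure_mono_null (subset_univ s) (by rw [ha, h, ENNReal.coe_zero])
      simp [this]
    · rw [ENNReal.mul_inv_cancel (by simpa using h) ENNReal.coe_ne_top, one_mul]

/-- A measure of prescribed finite mass can be split off from an infinite s-finite measure, in
such a way that the rest is a sum of probability measures. -/
theorem exists_add_sum_eq_of_measure_univ_eq_top {Z : Type*} [MeasurableSpace Z] (ρ : Measure Z)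
    [SFinite ρ] (hρ : ρ univ = ∞) {a : ℝ≥0∞} (ha : a ≠ ∞) :
    ∃ (α : Measure Z) (r : ℕ → Measure Z), α univ = a ∧ (∀ n, r n univ = 1) ∧
      α + Measure.sum r = ρ := by
  -- The mass `a` comes first, followed by infinitely many unit masses, so that the prescribed
  -- masses have infinite sum.
  obtain ⟨r, hr, rfl⟩ := exists_sum_eq_of_measure_univ_eq_top ρ hρ
    (b := fun n => if n = 0 then a.toNNReal else 1) (by
      rw [tsum_eq_zero_add' ENNReal.summable]
      simp)
  refine ⟨r 0, fun n => r (n + 1), by simp [hr, ha], fun n => by simp [hr], ?_⟩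
  ext s hs
  simp only [Measure.add_apply, Measure.sum_apply _ hs]
  exact (tsum_eq_zero_add' (f := fun i => r i s) ENNReal.summable).symm

end Splitting

/-! ### Coupling measures. -/

namespace IsCouplingMeasure

variable {S₁ : Type u} {S₂ : Type v} [MeasurableSpace S₁] [MeasurableSpace S₂]

theorem add {μ₁ μ₁' : Measure S₁} {μ₂ μ₂' : Measure S₂} {ν ν' : Measure (S₁ × S₂)}
    (h : IsCouplingMeasure μ₁ μ₂ ν) (h' : IsCouplingMeasure μ₁' μ₂' ν') :
    IsCouplingMeasure (μ₁ + μ₁') (μ₂ + μ₂') (ν + ν') :=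
  ⟨by rw [Measure.map_add _ _ measurable_fst, h.map_fst, h'.map_fst],
    by rw [Measure.map_add _ _ measurable_snd, h.map_snd, h'.map_snd]⟩

theorem sum {μ₁ : ℕ → Measure S₁} {μ₂ : ℕ → Measure S₂} {ν : ℕ → Measure (S₁ × S₂)}
    (h : ∀ n, IsCouplingMeasure (μ₁ n) (μ₂ n) (ν n)) :
    IsCouplingMeasure (Measure.sum μ₁) (Measure.sum μ₂) (Measure.sum ν) :=
  ⟨by simp only [Measure.map_sum measurable_fst.aemeasurable, (h _).map_fst],
    by simp only [Measure.map_sum measurable_snd.aemeasurable, (h _).map_snd]⟩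

/-- The normalized product measure couples two finite measures of the same mass. -/
theorem of_measure_univ_eq {μ₁ : Measure S₁} {μ₂ : Measure S₂} [IsFiniteMeasure μ₁]
    [IsFiniteMeasure μ₂] (h : μ₁ univ = μ₂ univ) :
    IsCouplingMeasure μ₁ μ₂ ((μ₁ univ)⁻¹ • μ₁.prod μ₂) := by
  rcases eq_or_ne (μ₁ univ) 0 with h0 | h0
  · have e1 : μ₁ = 0 := Measure.measure_univ_eq_zero.1 h0
    have e2 : μ₂ = 0 := Measure.measure_univ_eq_zero.1 (h ▸ h0)
    subst e1 e2
    constructor <;> simp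
  · constructor
    · rw [Measure.map_smul, Measure.map_fst_prod, ← h, smul_smul,
        ENNReal.inv_mul_cancel h0 (measure_ne_top _ _), one_smul]
    · rw [Measure.map_smul, Measure.map_snd_prod, smul_smul,
        ENNReal.inv_mul_cancel h0 (measure_ne_top _ _), one_smul]

theorem exists_of_measure_univ_eq {μ₁ : Measure S₁} {μ₂ : Measure S₂} {a : ℝ≥0∞} (ha : a ≠ ∞)
    (h₁ : μ₁ univ = a) (h₂ : μ₂ univ = a) : ∃ ν, IsCouplingMeasure μ₁ μ₂ ν := by
  have : IsFiniteMeasure μ₁ := ⟨by rw [h₁]; exact ha.lt_top⟩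
  have : IsFiniteMeasure μ₂ := ⟨by rw [h₂]; exact ha.lt_top⟩
  exact ⟨_, of_measure_univ_eq (h₁.trans h₂.symm)⟩

theorem isPartialCoupling {X : Type*} [MeasurableSpace X] {w : X → ℝ} (hw : Measurable w)
    {m₁ m₂ : Measure X} {m : Measure (X × X)} (h : IsCouplingMeasure m₁ m₂ m)
    (h₁ : m₁ {x | w x = 0} = 0) (h₂ : m₂ {x | w x = 0} = 0) :
    IsPartialCoupling w m₁ m₂ m := by
  rw [← h.map_fst, Measure.map_apply measurable_fst (measurableSet_weight_eq hw)] at h₁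
  rw [← h.map_snd, Measure.map_apply measurable_snd (measurableSet_weight_eq hw)] at h₂
  refine ⟨measure_mono_null (fun p hp => hp.1) h₁, ?_, ?_⟩
  · rw [Measure.restrict_eq_self_of_ae_mem, h.map_fst]
    exact compl_mem_ae_iff.2 h₁
  · rw [Measure.restrict_eq_self_of_ae_mem, h.map_snd]
    exact compl_mem_ae_iff.2 h₂

end IsCouplingMeasure

/-! ### Truncation to large weights, and completion of partial couplings to couplings. -/

section Truncation

open Filter Topology Classical

variable {X : Type*} {w : X → ℝ} {δ : ℝ} {x₀ : X}

/-- The truncation of a kernel to the points of weight larger than `δ`. -/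
noncomputable def truncKernel (w : X → ℝ) (δ : ℝ) (V : X → X → ℝ) (x y : X) : ℝ :=
  if δ < w x ∧ δ < w y then V x y else 0

/-- The map that sends all points of weight at most `δ` to `x₀`. -/
noncomputable def collapse (w : X → ℝ) (δ : ℝ) (x₀ x : X) : X := if δ < w x then x else x₀

theorem lt_weight_collapse (hδ : 0 < δ) (hx₀ : w x₀ = 0) {x : X} :
    δ < w (collapse w δ x₀ x) ↔ δ < w x := by
  unfold collapse
  split_ifs with h
  · rfl
  · simp only [hx₀, h, iff_false]
    exact not_lt.2 hδ.le

/-- Collapsing alters only points of weight at most `δ`, and the truncated kernel is 0 there.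
Measures with the same collapsed image thus cannot be told apart by truncated kernels. -/
theorem truncKernel_collapse (hδ : 0 < δ) (hx₀ : w x₀ = 0) (V : X → X → ℝ) (x y : X) :
    truncKernel w δ V (collapse w δ x₀ x) (collapse w δ x₀ y) = truncKernel w δ V x y := by
  simp only [truncKernel, lt_weight_collapse hδ hx₀]
  split_ifs with h
  · simp only [collapse, h.1, h.2, if_true]
  · rfl

theorem truncKernel_eq_indicator (V : X → X → ℝ) : (fun z : X × X => truncKernel w δ V z.1 z.2) =
    ({x | δ < w x} ×ˢ {x | δ < w x}).indicator fun z => V z.1 z.2 := by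
  ext z
  simp only [truncKernel, indicator, mem_prod, mem_ofPred_eq]

variable [MeasurableSpace X]

theorem measurable_collapse (hw : Measurable w) : Measurable (collapse w δ x₀) :=
  Measurable.ite (measurableSet_lt measurable_const hw) measurable_id measurable_const

theorem measurableSet_lt_weight (hw : Measurable w) : MeasurableSet {x | δ < w x} :=
  measurableSet_lt measurable_const hw

theorem IsWeightedKernel.truncKernel (hw : Measurable w) (hδ : 0 < δ) {m : Measure X}
    {V : X → X → ℝ} (hV : IsWeightedKernel w m V) :
    IsWeightedKernel w m (truncKernel w δ V) := by
  refine ⟨?_, fun x y hx => if_neg fun h => ?_, fun x y hy => if_neg fun h => ?_⟩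
  · rw [truncKernel_eq_indicator]
    exact hV.integrable.indicator ((measurableSet_lt_weight hw).prod (measurableSet_lt_weight hw))
  · linarith [h.1]
  · linarith [h.2]

/-- Dominated convergence: where both weights are positive the truncation is exact for small `δ`,
and elsewhere `V` is 0. -/
theorem IsWeightedKernel.tendsto_truncKernel (hw : Measurable w) (h0 : ∀ x, 0 ≤ w x)
    {m : Measure X} {V : X → X → ℝ} (hV : IsWeightedKernel w m V) :
    Tendsto (fun δ => ∫ z : X × X, |V z.1 z.2 - _root_.truncKernel w δ V z.1 z.2| ∂(m.prod m))
      (𝓝[>] 0) (𝓝 0) := by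
  rw [show 𝓝 (0 : ℝ) = 𝓝 (∫ z : X × X, (0 : ℝ) ∂(m.prod m)) by simp]
  refine tendsto_integral_filter_of_dominated_convergence (fun z => ‖V z.1 z.2‖) ?_ ?_
    hV.integrable.norm ?_
  · filter_upwards [self_mem_nhdsWithin] with δ hδ
    exact (hV.integrable.sub (hV.truncKernel hw hδ).integrable).abs.aestronglyMeasurable
  · refine Eventually.of_forall fun δ => ae_of_all _ fun z => ?_
    simp only [Real.norm_eq_abs, abs_abs, _root_.truncKernel]
    split_ifs <;> simp
  · refine ae_of_all _ fun z => ?_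
    by_cases h : w z.1 ≠ 0 ∧ w z.2 ≠ 0
    · refine tendsto_const_nhds.congr' ?_
      have hpos : 0 < min (w z.1) (w z.2) :=
        lt_min (lt_of_le_of_ne (h0 _) h.1.symm) (lt_of_le_of_ne (h0 _) h.2.symm)
      filter_upwards [mem_nhdsWithin_of_mem_nhds (Iio_mem_nhds hpos)] with δ hδ
      rw [_root_.truncKernel, if_pos ⟨(lt_min_iff.1 hδ).1, (lt_min_iff.1 hδ).2⟩, sub_self, abs_zero]
    · refine tendsto_const_nhds.congr fun δ => ?_
      simp only [_root_.truncKernel, hV.eq_zero h, ite_self, sub_self, abs_zero]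

variable {m₁ m₂ : Measure X} {m : Measure (X × X)}

/-- The points of `X × X` at which one of the weights is larger than `δ`. -/
def largeSet (w : X → ℝ) (δ : ℝ) : Set (X × X) := {p | δ < w p.1 ∨ δ < w p.2}

theorem measurableSet_largeSet (hw : Measurable w) : MeasurableSet (largeSet w δ) :=
  (measurableSet_lt measurable_const (hw.comp measurable_fst)).union
    (measurableSet_lt measurable_const (hw.comp measurable_snd))

theorem measure_lt_weight_lt_top (hδ : 0 < δ) (hm₁ : Integrable w m₁) : m₁ {x | δ < w x} < ∞ :=
  hm₁.measure_gt_lt_top hδ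

namespace IsPartialCoupling

theorem measure_fst_preimage (h : IsPartialCoupling w m₁ m₂ m) {s : Set X} (hs : MeasurableSet s)
    (hsw : ∀ x ∈ s, w x ≠ 0) : m (Prod.fst ⁻¹' s) = m₁ s := by
  rw [← h.fst, Measure.map_apply measurable_fst hs, Measure.restrict_apply (measurable_fst hs),
    inter_eq_left.2 fun p hp => ?_]
  exact hsw _ hp

theorem measure_snd_preimage (h : IsPartialCoupling w m₁ m₂ m) {s : Set X} (hs : MeasurableSet s)
    (hsw : ∀ x ∈ s, w x ≠ 0) : m (Prod.snd ⁻¹' s) = m₂ s := by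
  rw [← h.snd, Measure.map_apply measurable_snd hs, Measure.restrict_apply (measurable_snd hs),
    inter_eq_left.2 fun p hp => ?_]
  exact hsw _ hp

/-- By Markov's inequality each marginal gives finite mass to the points of weight above `δ`. -/
theorem measure_largeSet_lt_top (h : IsPartialCoupling w m₁ m₂ m) (hw : Measurable w) (hδ : 0 < δ)
    (hm₁ : Integrable w m₁) (hm₂ : Integrable w m₂) : m (largeSet w δ) < ∞ := by
  have hne : ∀ x ∈ {x | δ < w x}, w x ≠ 0 := fun x hx => (hδ.trans hx).ne'
  refine (measure_union_le (Prod.fst ⁻¹' {x | δ < w x}) (Prod.snd ⁻¹' {x | δ < w x})).trans_lt ?_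
  rw [h.measure_fst_preimage (measurableSet_lt_weight hw) hne,
    h.measure_snd_preimage (measurableSet_lt_weight hw) hne]
  exact ENNReal.add_lt_top.2 ⟨measure_lt_weight_lt_top hδ hm₁, measure_lt_weight_lt_top hδ hm₂⟩

/-- Collapsing fixes the points of weight above `δ` and creates no new ones. This supplies the
integrability of truncated kernels for the collapsed measure. -/
theorem map_fst_map_collapse (h : IsPartialCoupling w m₁ m₂ m) (hw : Measurable w) (hδ : 0 < δ)
    (hx₀ : w x₀ = 0) :
    ((((m.restrict (largeSet w δ)).map (Prod.map (collapse w δ x₀) (collapse w δ x₀))).restrict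
      {p | δ < w p.1}).map Prod.fst) = m₁.restrict {x | δ < w x} := by
  have hψ : Measurable (Prod.map (collapse w δ x₀) (collapse w δ x₀)) :=
    (measurable_collapse hw).prodMap (measurable_collapse hw)
  have hB : MeasurableSet {p : X × X | δ < w p.1} := measurable_fst (measurableSet_lt_weight hw)
  ext s hs
  rw [Measure.map_apply measurable_fst hs, Measure.restrict_apply (measurable_fst hs),
    Measure.map_apply hψ ((measurable_fst hs).inter hB),
    Measure.restrict_apply (hψ ((measurable_fst hs).inter hB)), Measure.restrict_apply hs,
    ← h.measure_fst_preimage (hs.inter (measurableSet_lt_weight hw))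
      fun x hx => (hδ.trans hx.2).ne']
  congr 1
  ext p
  simp only [mem_inter_iff, mem_preimage, Prod.map_fst, mem_ofPred_eq, lt_weight_collapse hδ hx₀,
    largeSet]
  constructor
  · rintro ⟨⟨h1, h2⟩, -⟩
    rw [collapse, if_pos h2] at h1
    exact ⟨h1, h2⟩
  · rintro ⟨h1, h2⟩
    rw [collapse, if_pos h2]
    exact ⟨⟨h1, h2⟩, Or.inl h2⟩

theorem map_snd_map_collapse (h : IsPartialCoupling w m₁ m₂ m) (hw : Measurable w) (hδ : 0 < δ)
    (hx₀ : w x₀ = 0) :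
    ((((m.restrict (largeSet w δ)).map (Prod.map (collapse w δ x₀) (collapse w δ x₀))).restrict
      {p | δ < w p.2}).map Prod.snd) = m₂.restrict {x | δ < w x} := by
  have hψ : Measurable (Prod.map (collapse w δ x₀) (collapse w δ x₀)) :=
    (measurable_collapse hw).prodMap (measurable_collapse hw)
  have hB : MeasurableSet {p : X × X | δ < w p.2} := measurable_snd (measurableSet_lt_weight hw)
  ext s hs
  rw [Measure.map_apply measurable_snd hs, Measure.restrict_apply (measurable_snd hs),
    Measure.map_apply hψ ((measurable_snd hs).inter hB),
    Measure.restrict_apply (hψ ((measurable_snd hs).inter hB)), Measure.restrict_apply hs,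
    ← h.measure_snd_preimage (hs.inter (measurableSet_lt_weight hw))
      fun x hx => (hδ.trans hx.2).ne']
  congr 1
  ext p
  simp only [mem_inter_iff, mem_preimage, Prod.map_snd, mem_ofPred_eq, lt_weight_collapse hδ hx₀,
    largeSet]
  constructor
  · rintro ⟨⟨h1, h2⟩, -⟩
    rw [collapse, if_pos h2] at h1
    exact ⟨h1, h2⟩
  · rintro ⟨h1, h2⟩
    rw [collapse, if_pos h2]
    exact ⟨⟨h1, h2⟩, Or.inr h2⟩

variable [SigmaFinite m₁] [SigmaFinite m₂]

/-- The cut norm of the truncated difference kernel depends only on the collapsed measure. -/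
theorem cutNorm_truncKernel (h : IsPartialCoupling w m₁ m₂ m) (hw : Measurable w) (hδ : 0 < δ)
    (hx₀ : w x₀ = 0) (hm₁ : Integrable w m₁) (hm₂ : Integrable w m₂) {V₁ V₂ : X → X → ℝ}
    (h₁ : IsWeightedKernel w m₁ V₁) (h₂ : IsWeightedKernel w m₂ V₂) :
    cutNorm m (diffKernel (truncKernel w δ V₁) (truncKernel w δ V₂)) =
      cutNorm ((m.restrict (largeSet w δ)).map (Prod.map (collapse w δ x₀) (collapse w δ x₀)))
        (diffKernel (truncKernel w δ V₁) (truncKernel w δ V₂)) := by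
  have hψ : Measurable (Prod.map (collapse w δ x₀) (collapse w δ x₀)) :=
    (measurable_collapse hw).prodMap (measurable_collapse hw)
  have := h.sigmaFinite
  have : IsFiniteMeasure (m.restrict (largeSet w δ)) :=
    ⟨by rw [Measure.restrict_apply_univ]; exact h.measure_largeSet_lt_top hw hδ hm₁ hm₂⟩
  rw [cutNorm_map hψ]
  · rw [← cutNorm_restrict (μ := m) (D := largeSet w δ)]
    · congr 1
      ext s t
      simp only [diffKernel, Prod.map_fst, Prod.map_snd, truncKernel_collapse hδ hx₀]
    · intro s t hst
      have e1 : ¬ (δ < w s.1 ∧ δ < w t.1) := fun hh => hst ⟨Or.inl hh.1, Or.inl hh.2⟩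
      have e2 : ¬ (δ < w s.2 ∧ δ < w t.2) := fun hh => hst ⟨Or.inr hh.1, Or.inr hh.2⟩
      simp only [diffKernel, truncKernel, if_neg e1, if_neg e2, sub_zero]
  · have i₁ : Integrable (fun z : X × X => truncKernel w δ V₁ z.1 z.2)
        ((m₁.restrict {x | δ < w x}).prod (m₁.restrict {x | δ < w x})) :=
      (h₁.truncKernel hw hδ).integrable.mono_measure
        (Measure.prod_mono Measure.restrict_le_self Measure.restrict_le_self)
    have i₂ : Integrable (fun z : X × X => truncKernel w δ V₂ z.1 z.2)
        ((m₂.restrict {x | δ < w x}).prod (m₂.restrict {x | δ < w x})) :=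
      (h₂.truncKernel hw hδ).integrable.mono_measure
        (Measure.prod_mono Measure.restrict_le_self Measure.restrict_le_self)
    exact (integrable_pullback measurable_fst (h.map_fst_map_collapse hw hδ hx₀)
      (fun s t hst => if_neg hst) i₁).sub (integrable_pullback measurable_snd
        (h.map_snd_map_collapse hw hδ hx₀) (fun s t hst => if_neg hst) i₂)

end IsPartialCoupling

/-- The collapsed image of a measure whose second coordinate is collapsed depends only on the
first marginal. -/
theorem map_collapse_of_snd {ν : Measure (X × X)} (hw : Measurable w)
    (h : ∀ᵐ p ∂ν, ¬ δ < w p.2) :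
    ν.map (Prod.map (collapse w δ x₀) (collapse w δ x₀)) =
      (ν.map Prod.fst).map fun x => (collapse w δ x₀ x, x₀) := by
  have hc : Measurable (collapse w δ x₀) := measurable_collapse hw
  rw [Measure.map_map (by fun_prop) measurable_fst]
  refine Measure.map_congr ?_
  filter_upwards [h] with p hp
  simp [Prod.map, collapse, hp]

theorem map_collapse_of_fst {ν : Measure (X × X)} (hw : Measurable w)
    (h : ∀ᵐ p ∂ν, ¬ δ < w p.1) :
    ν.map (Prod.map (collapse w δ x₀) (collapse w δ x₀)) =
      (ν.map Prod.snd).map fun x => (x₀, collapse w δ x₀ x) := by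
  have hc : Measurable (collapse w δ x₀) := measurable_collapse hw
  rw [Measure.map_map (by fun_prop) measurable_snd]
  refine Measure.map_congr ?_
  filter_upwards [h] with p hp
  simp [Prod.map, collapse, hp]

omit [MeasurableSpace X] in
theorem weight_ne_zero_of_mem_largeSet (hδ : 0 < δ) {p : X × X} (hp : p ∈ largeSet w δ) :
    w p.1 ≠ 0 ∨ w p.2 ≠ 0 :=
  hp.imp (fun h => (hδ.trans h).ne') fun h => (hδ.trans h).ne'

/-- Partial couplings of infinite measures can be completed without changing the collapsed
measure. -/
theorem IsPartialCoupling.exists_isCouplingMeasure_map_eq [SigmaFinite m₁] [SigmaFinite m₂]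
    (h : IsPartialCoupling w m₁ m₂ m) (hw : Measurable w) (hδ : 0 < δ)
    (hm₁ : Integrable w m₁) (hm₂ : Integrable w m₂) (htop₁ : m₁ univ = ∞) (htop₂ : m₂ univ = ∞) :
    ∃ m', IsCouplingMeasure m₁ m₂ m' ∧
      (m'.restrict (largeSet w δ)).map (Prod.map (collapse w δ x₀) (collapse w δ x₀)) =
      (m.restrict (largeSet w δ)).map (Prod.map (collapse w δ x₀) (collapse w δ x₀)) := by
  have := h.sigmaFinite
  set D := largeSet w δ with hD
  have hDm : MeasurableSet D := measurableSet_largeSet hw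
  have hDfin : m D < ∞ := h.measure_largeSet_lt_top hw hδ hm₁ hm₂
  set N₁ : Set (X × X) := {p | w p.1 ≠ 0} with hN₁
  set N₂ : Set (X × X) := {p | w p.2 ≠ 0} with hN₂
  have hN₁m : MeasurableSet N₁ := measurableSet_weight_ne_fst hw
  have hN₂m : MeasurableSet N₂ := measurableSet_weight_ne_snd hw
  have hψ : Measurable (Prod.map (collapse w δ x₀) (collapse w δ x₀)) :=
    (measurable_collapse hw).prodMap (measurable_collapse hw)
  -- the part of `m` on `D` with both, with only the first, with only the second weight non-zero
  set a₀ := m.restrict (D ∩ (N₁ ∩ N₂)) with ha₀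
  set a₁ := m.restrict (D ∩ (N₁ \ N₂)) with ha₁
  set a₂ := m.restrict (D ∩ (N₂ \ N₁)) with ha₂
  have hsplit₁ : m.restrict (D ∩ N₁) = a₀ + a₁ := by
    rw [ha₀, ha₁, ← Measure.restrict_union]
    · rw [← inter_union_distrib_left, inter_union_sdiff]
    · exact (disjoint_sdiff_inter.symm).mono inter_subset_right inter_subset_right
    · exact hDm.inter (hN₁m.diff hN₂m)
  have hsplit₂ : m.restrict (D ∩ N₂) = a₀ + a₂ := by
    rw [ha₀, ha₂, ← Measure.restrict_union]
    · rw [← inter_union_distrib_left, inter_comm N₁, inter_union_sdiff]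
    · rw [inter_comm N₁]
      exact (disjoint_sdiff_inter.symm).mono inter_subset_right inter_subset_right
    · exact hDm.inter (hN₂m.diff hN₁m)
  have hsplit : m.restrict D = a₀ + a₁ + a₂ := by
    rw [← hsplit₁, ha₂, ← Measure.restrict_union]
    · congr 1
      ext p
      have : p ∈ D → w p.1 ≠ 0 ∨ w p.2 ≠ 0 := weight_ne_zero_of_mem_largeSet hδ
      simp only [mem_union, mem_inter_iff, Set.mem_sdiff, hN₁, hN₂, mem_ofPred_eq]
      refine ⟨fun hp => ?_, fun hp => hp.elim And.left And.left⟩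
      by_cases hp₁ : w p.1 = 0
      · exact Or.inr ⟨hp, (this hp).resolve_left (not_not.2 hp₁), not_not.2 hp₁⟩
      · exact Or.inl ⟨hp, hp₁⟩
    · rw [disjoint_left]
      rintro p ⟨-, hp⟩ ⟨-, -, hp'⟩
      exact hp' hp
    · exact hDm.inter (hN₂m.diff hN₁m)
  have hle : ∀ s : Set (X × X), s ⊆ D → m s ≠ ∞ := fun s hs => ((measure_mono hs).trans_lt hDfin).ne
  -- the rest of the marginals
  set ρ₁ := (m.restrict (Dᶜ ∩ N₁)).map Prod.fst with hρ₁
  set ρ₂ := (m.restrict (Dᶜ ∩ N₂)).map Prod.snd with hρ₂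
  have hm₁eq : m₁ = a₀.map Prod.fst + a₁.map Prod.fst + ρ₁ := by
    rw [← Measure.map_add _ _ measurable_fst, ← hsplit₁, hρ₁, ← Measure.map_add _ _ measurable_fst,
      ← Measure.restrict_restrict hDm, ← Measure.restrict_restrict hDm.compl,
      Measure.restrict_add_restrict_compl hDm, h.fst]
  have hm₂eq : m₂ = a₀.map Prod.snd + a₂.map Prod.snd + ρ₂ := by
    rw [← Measure.map_add _ _ measurable_snd, ← hsplit₂, hρ₂, ← Measure.map_add _ _ measurable_snd,
      ← Measure.restrict_restrict hDm, ← Measure.restrict_restrict hDm.compl,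
      Measure.restrict_add_restrict_compl hDm, h.snd]
  -- The part on `D` has finite mass, so all of the infinite mass is in the rest.
  have hρ₁top : ρ₁ univ = ∞ := by
    rw [hm₁eq, Measure.add_apply, Measure.add_apply, ENNReal.add_eq_top] at htop₁
    refine htop₁.resolve_left ?_
    rw [Measure.map_apply measurable_fst .univ, Measure.map_apply measurable_fst .univ, preimage_univ,
      ha₀, ha₁, Measure.restrict_apply_univ, Measure.restrict_apply_univ]
    exact ENNReal.add_ne_top.2 ⟨hle _ inter_subset_left, hle _ inter_subset_left⟩
  have hρ₂top : ρ₂ univ = ∞ := by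
    rw [hm₂eq, Measure.add_apply, Measure.add_apply, ENNReal.add_eq_top] at htop₂
    refine htop₂.resolve_left ?_
    rw [Measure.map_apply measurable_snd .univ, Measure.map_apply measurable_snd .univ, preimage_univ,
      ha₀, ha₂, Measure.restrict_apply_univ, Measure.restrict_apply_univ]
    exact ENNReal.add_ne_top.2 ⟨hle _ inter_subset_left, hle _ inter_subset_left⟩
  have hBm : MeasurableSet {x | δ < w x} := measurableSet_lt_weight hw
  have hρ₁B : ρ₁ {x | δ < w x} = 0 := by
    rw [hρ₁, Measure.map_apply measurable_fst hBm, Measure.restrict_apply (measurable_fst hBm)]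
    convert measure_empty (μ := m)
    ext p
    simp only [hD, largeSet, mem_inter_iff, mem_preimage, mem_ofPred_eq, mem_compl_iff,
      mem_empty_iff_false, iff_false]
    tauto
  have hρ₂B : ρ₂ {x | δ < w x} = 0 := by
    rw [hρ₂, Measure.map_apply measurable_snd hBm, Measure.restrict_apply (measurable_snd hBm)]
    convert measure_empty (μ := m)
    ext p
    simp only [hD, largeSet, mem_inter_iff, mem_preimage, mem_ofPred_eq, mem_compl_iff,
      mem_empty_iff_false, iff_false]
    tauto
  -- `α₁` gets the mass of `a₂`, whose first coordinates are at infinity: it will replace them.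
  -- Since `ρ₁` lives on weights at most `δ`, the collapse does not detect the replacement. `α₂`
  -- does the same for `a₁`.
  obtain ⟨α₁, r₁, hα₁, hr₁, hsum₁⟩ := exists_add_sum_eq_of_measure_univ_eq_top ρ₁ hρ₁top
    (a := m (D ∩ (N₂ \ N₁))) (hle _ inter_subset_left)
  obtain ⟨α₂, r₂, hα₂, hr₂, hsum₂⟩ := exists_add_sum_eq_of_measure_univ_eq_top ρ₂ hρ₂top
    (a := m (D ∩ (N₁ \ N₂))) (hle _ inter_subset_left)
  obtain ⟨γ₁, hγ₁⟩ := IsCouplingMeasure.exists_of_measure_univ_eq (μ₁ := a₁.map Prod.fst) (μ₂ := α₂)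
    (hle (D ∩ (N₁ \ N₂)) inter_subset_left)
    (by rw [Measure.map_apply measurable_fst .univ, preimage_univ, ha₁,
      Measure.restrict_apply_univ]) hα₂
  obtain ⟨γ₂, hγ₂⟩ := IsCouplingMeasure.exists_of_measure_univ_eq (μ₁ := α₁) (μ₂ := a₂.map Prod.snd)
    (hle (D ∩ (N₂ \ N₁)) inter_subset_left) hα₁
    (by rw [Measure.map_apply measurable_snd .univ, preimage_univ, ha₂,
      Measure.restrict_apply_univ])
  -- The leftovers of the two marginals consist of unit masses and are coupled piece by piece.
  have hγ₃ := fun n => IsCouplingMeasure.exists_of_measure_univ_eq ENNReal.one_ne_top (hr₁ n) (hr₂ n)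
  choose γ₃ hγ₃ using hγ₃
  rw [← hsum₁, Measure.add_apply, add_eq_zero] at hρ₁B
  rw [← hsum₂, Measure.add_apply, add_eq_zero] at hρ₂B
  have hγ₃' := IsCouplingMeasure.sum hγ₃
  have key₁ : ∀ {μ₁ μ₂ : Measure X} {γ : Measure (X × X)}, IsCouplingMeasure μ₁ μ₂ γ →
      μ₁ {x | δ < w x} = 0 → ∀ᵐ p ∂γ, ¬ δ < w p.1 := by
    intro μ₁ μ₂ γ hγ h0
    rw [← hγ.map_fst, Measure.map_apply measurable_fst hBm] at h0
    exact compl_mem_ae_iff.2 h0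
  have key₂ : ∀ {μ₁ μ₂ : Measure X} {γ : Measure (X × X)}, IsCouplingMeasure μ₁ μ₂ γ →
      μ₂ {x | δ < w x} = 0 → ∀ᵐ p ∂γ, ¬ δ < w p.2 := by
    intro μ₁ μ₂ γ hγ h0
    rw [← hγ.map_snd, Measure.map_apply measurable_snd hBm] at h0
    exact compl_mem_ae_iff.2 h0
  have hae₁ : ∀ᵐ p ∂a₁, p ∈ D ∧ ¬ δ < w p.2 := by
    filter_upwards [ae_restrict_mem (hDm.inter (hN₁m.diff hN₂m))] with p hp
    refine ⟨hp.1, fun hlt => hp.2.2 (hδ.trans hlt).ne'⟩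
  have hae₂ : ∀ᵐ p ∂a₂, p ∈ D ∧ ¬ δ < w p.1 := by
    filter_upwards [ae_restrict_mem (hDm.inter (hN₂m.diff hN₁m))] with p hp
    refine ⟨hp.1, fun hlt => hp.2.2 (hδ.trans hlt).ne'⟩
  have hγ₁D : γ₁.restrict D = γ₁ := by
    refine Measure.restrict_eq_self_of_ae_mem ?_
    have : ∀ᵐ x ∂(γ₁.map Prod.fst), δ < w x := by
      rw [hγ₁.map_fst, ae_map_iff measurable_fst.aemeasurable hBm]
      filter_upwards [hae₁] with p hp
      exact hp.1.resolve_right hp.2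
    filter_upwards [ae_of_ae_map measurable_fst.aemeasurable this] with p hp
    exact Or.inl hp
  have hγ₂D : γ₂.restrict D = γ₂ := by
    refine Measure.restrict_eq_self_of_ae_mem ?_
    have : ∀ᵐ x ∂(γ₂.map Prod.snd), δ < w x := by
      rw [hγ₂.map_snd, ae_map_iff measurable_snd.aemeasurable hBm]
      filter_upwards [hae₂] with p hp
      exact hp.1.resolve_left hp.2
    filter_upwards [ae_of_ae_map measurable_snd.aemeasurable this] with p hp
    exact Or.inr hp
  -- Both coordinates have weight at most `δ` here, so this part misses `D` altogether.
  have hγ₃D : (Measure.sum γ₃).restrict D = 0 := by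
    rw [Measure.restrict_eq_zero, ← compl_compl D, ← mem_ae_iff]
    filter_upwards [key₁ hγ₃' hρ₁B.2, key₂ hγ₃' hρ₂B.2] with p hp hp'
    exact fun hh => hh.elim hp hp'
  have ha₀D : a₀.restrict D = a₀ := by
    rw [ha₀, Measure.restrict_restrict hDm, ← inter_assoc, inter_self]
  refine ⟨a₀ + γ₁ + (γ₂ + Measure.sum γ₃), ?_, ?_⟩
  · have hc₀ : IsCouplingMeasure (a₀.map Prod.fst) (a₀.map Prod.snd) a₀ := ⟨rfl, rfl⟩
    convert (hc₀.add hγ₁).add (hγ₂.add hγ₃') using 1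
    · rw [hsum₁, hm₁eq]
    · rw [hm₂eq, ← hsum₂]
      abel
  -- After collapsing, `γ₁` and `a₁` both have second coordinate `x₀` and the same first marginal,
  -- so they agree; likewise `γ₂` and `a₂` with the coordinates exchanged.
  · rw [Measure.restrict_add, Measure.restrict_add, Measure.restrict_add, hγ₁D, hγ₂D, hγ₃D, ha₀D,
      add_zero, hsplit, Measure.map_add _ _ hψ, Measure.map_add _ _ hψ, Measure.map_add _ _ hψ,
      Measure.map_add _ _ hψ, map_collapse_of_snd hw (key₂ hγ₁ hρ₂B.1), hγ₁.map_fst,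
      map_collapse_of_fst hw (key₁ hγ₂ hρ₁B.1), hγ₂.map_snd,
      map_collapse_of_snd hw (hae₁.mono fun p hp => hp.2),
      map_collapse_of_fst hw (hae₂.mono fun p hp => hp.2)]

/-- Partial couplings of infinite measures are approximated by coupling measures. -/
theorem IsPartialCoupling.exists_isCouplingMeasure_cutNorm_le [SigmaFinite m₁] [SigmaFinite m₂]
    (h : IsPartialCoupling w m₁ m₂ m) (hw : Measurable w) (h0 : ∀ x, 0 ≤ w x) (hx₀ : w x₀ = 0)
    (hm₁ : Integrable w m₁) (hm₂ : Integrable w m₂) (htop₁ : m₁ univ = ∞) (htop₂ : m₂ univ = ∞)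
    {V₁ V₂ : X → X → ℝ} (h₁ : IsWeightedKernel w m₁ V₁) (h₂ : IsWeightedKernel w m₂ V₂)
    {ε : ℝ} (hε : 0 < ε) :
    ∃ m', IsCouplingMeasure m₁ m₂ m' ∧
      cutNorm m' (diffKernel V₁ V₂) ≤ cutNorm m (diffKernel V₁ V₂) + ε := by
  have hε4 : 0 < ε / 4 := by positivity
  -- Two kernels are truncated, once for `m` and once for `m'`: four errors of `ε / 4`.
  obtain ⟨δ, ⟨hd₁, hd₂⟩, hδ⟩ := (((h₁.tendsto_truncKernel hw h0).eventually_le_const hε4).and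
    ((h₂.tendsto_truncKernel hw h0).eventually_le_const hε4)).and self_mem_nhdsWithin |>.exists
  have hδ : 0 < δ := hδ
  obtain ⟨m', hm', heq⟩ := h.exists_isCouplingMeasure_map_eq (x₀ := x₀) hw hδ hm₁ hm₂ htop₁ htop₂
  have hp' := hm'.isPartialCoupling hw (h.measure_fst_zero hw) (h.measure_snd_zero hw)
  have t₁ := h₁.truncKernel hw hδ
  have t₂ := h₂.truncKernel hw hδ
  have e := hp'.cutNorm_truncKernel hw hδ hx₀ hm₁ hm₂ h₁ h₂
  rw [heq, ← h.cutNorm_truncKernel hw hδ hx₀ hm₁ hm₂ h₁ h₂] at e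
  have b₁ := hp'.cutNorm_le_add h₁ h₂ t₁ t₂
  have b₂ := h.cutNorm_le_add t₁ t₂ h₁ h₂
  have c₁ : ∫ z : X × X, |_root_.truncKernel w δ V₁ z.1 z.2 - V₁ z.1 z.2| ∂(m₁.prod m₁) ≤ ε / 4 := by
    simpa only [abs_sub_comm] using hd₁
  have c₂ : ∫ z : X × X, |_root_.truncKernel w δ V₂ z.1 z.2 - V₂ z.1 z.2| ∂(m₂.prod m₂) ≤ ε / 4 := by
    simpa only [abs_sub_comm] using hd₂
  refine ⟨m', hm', ?_⟩
  linarith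

end Truncation

/-! ### Partial couplings by symmetry and from pairs of maps. -/

theorem IsPartialCoupling.swap {X : Type*} [MeasurableSpace X] {w : X → ℝ} {m₁ m₂ : Measure X}
    {m : Measure (X × X)} (h : IsPartialCoupling w m₁ m₂ m) (hw : Measurable w) :
    IsPartialCoupling w m₂ m₁ (m.map Prod.swap) := by
  refine ⟨?_, ?_, ?_⟩
  · rw [Measure.map_apply measurable_swap]
    · refine (congrArg m ?_).trans h.zero
      ext p
      exact and_comm
    · exact (measurable_fst (measurableSet_weight_eq hw)).inter
        (measurable_snd (measurableSet_weight_eq hw))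
  · rw [Measure.restrict_map measurable_swap (measurableSet_weight_ne_fst hw),
      Measure.map_map measurable_fst measurable_swap]
    exact h.snd
  · rw [Measure.restrict_map measurable_swap (measurableSet_weight_ne_snd hw),
      Measure.map_map measurable_snd measurable_swap]
    exact h.fst

/-- A pair of maps into a weighted space with the right marginals away from the zero set of the
weight induces a partial coupling. -/
theorem exists_isPartialCoupling_of_maps {S X : Type*} [MeasurableSpace S] [MeasurableSpace X]
    {μ : Measure S} [SigmaFinite μ] {w : X → ℝ} (hw : Measurable w) {m₁ m₂ : Measure X}
    [SigmaFinite m₁] [SigmaFinite m₂] {E₁ E₂ : S → X} (hE₁ : Measurable E₁) (hE₂ : Measurable E₂)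
    (h₁ : (μ.restrict {s | w (E₁ s) ≠ 0}).map E₁ = m₁)
    (h₂ : (μ.restrict {s | w (E₂ s) ≠ 0}).map E₂ = m₂) {V₁ V₂ : X → X → ℝ}
    (k₁ : IsWeightedKernel w m₁ V₁) (k₂ : IsWeightedKernel w m₂ V₂) :
    ∃ m, IsPartialCoupling w m₁ m₂ m ∧
      cutNorm m (diffKernel V₁ V₂) = cutNorm μ (fun s t => V₁ (E₁ s) (E₁ t) - V₂ (E₂ s) (E₂ t)) ∧
      ∀ K, MeasurableSet K → (∀ s, (E₁ s, E₂ s) ∈ K) → m Kᶜ = 0 := by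
  have hE : Measurable fun s => (E₁ s, E₂ s) := hE₁.prodMk hE₂
  set N₁ : Set S := {s | w (E₁ s) ≠ 0} with hN₁
  set N₂ : Set S := {s | w (E₂ s) ≠ 0} with hN₂
  have hD : MeasurableSet (N₁ ∪ N₂) :=
    (hE₁ (measurableSet_weight_ne hw)).union (hE₂ (measurableSet_weight_ne hw))
  -- Points that both maps send to infinity are discarded, as a partial coupling must not charge
  -- such pairs; the kernels vanish there, so the cut norm is unaffected.
  have hPC : IsPartialCoupling w m₁ m₂ ((μ.restrict (N₁ ∪ N₂)).map fun s => (E₁ s, E₂ s)) := by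
    refine ⟨?_, ?_, ?_⟩
    · have hz : MeasurableSet {p : X × X | w p.1 = 0 ∧ w p.2 = 0} :=
        (measurable_fst (measurableSet_weight_eq hw)).inter
          (measurable_snd (measurableSet_weight_eq hw))
      rw [Measure.map_apply hE hz, Measure.restrict_apply (hE hz)]
      convert measure_empty (μ := μ)
      ext s
      simp only [hN₁, hN₂, mem_inter_iff, mem_preimage, mem_ofPred_eq, mem_union,
        mem_empty_iff_false, iff_false]
      tauto
    · rw [Measure.restrict_map hE (measurableSet_weight_ne_fst hw), Measure.map_map measurable_fst hE,
        Measure.restrict_restrict (hE (measurableSet_weight_ne_fst hw)),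
        inter_eq_left.2 (show (fun s => (E₁ s, E₂ s)) ⁻¹' {p : X × X | w p.1 ≠ 0} ⊆ N₁ ∪ N₂ from
          fun s hs => Or.inl hs)]
      exact h₁
    · rw [Measure.restrict_map hE (measurableSet_weight_ne_snd hw), Measure.map_map measurable_snd hE,
        Measure.restrict_restrict (hE (measurableSet_weight_ne_snd hw)),
        inter_eq_left.2 (show (fun s => (E₁ s, E₂ s)) ⁻¹' {p : X × X | w p.2 ≠ 0} ⊆ N₁ ∪ N₂ from
          fun s hs => Or.inr hs)]
      exact h₂
  refine ⟨_, hPC, ?_, fun K hK hs => ?_⟩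
  · have := hPC.sigmaFinite
    rw [cutNorm_map hE (hPC.integrable_diffKernel k₁ k₂), cutNorm_restrict]
    · rfl
    · intro s t hst
      have e₁ : V₁ (E₁ s) (E₁ t) = 0 :=
        k₁.eq_zero fun hh => hst ⟨Or.inl hh.1, Or.inl hh.2⟩
      have e₂ : V₂ (E₂ s) (E₂ t) = 0 :=
        k₂.eq_zero fun hh => hst ⟨Or.inr hh.1, Or.inr hh.2⟩
      simp only [diffKernel, e₁, e₂, sub_zero]
  · rw [Measure.map_apply hE hK.compl]
    convert measure_empty (μ := μ.restrict (N₁ ∪ N₂))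
    ext s
    simpa using hs s

theorem Coupling.sigmaFinite {S₁ : Type u} {S₂ : Type v} [MeasurableSpace S₁] [MeasurableSpace S₂]
    {μ₁ : Measure S₁} {μ₂ : Measure S₂} [SigmaFinite μ₁] (c : Coupling μ₁ μ₂) : SigmaFinite c.μ :=
  SigmaFinite.of_map _ c.measurePreserving₁.measurable.aemeasurable
    (by rw [c.measurePreserving₁.map_eq]; infer_instance)

/-! ### Graphons transported to a weighted space. -/

namespace Graphon

theorem couplingCutNorm_nonneg (W₁ : Graphon.{u}) (W₂ : Graphon.{v}) (c : Coupling W₁.μ W₂.μ) :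
    0 ≤ couplingCutNorm W₁ W₂ c :=
  cutNorm_nonneg _ _

theorem bddBelow_couplingCutNorm (W₁ : Graphon.{u}) (W₂ : Graphon.{v}) :
    BddBelow (range fun c : Coupling W₁.μ W₂.μ => couplingCutNorm W₁ W₂ c) :=
  ⟨0, by rintro _ ⟨c, rfl⟩; exact couplingCutNorm_nonneg W₁ W₂ c⟩

theorem integrable_coupling (W₁ : Graphon.{u}) (W₂ : Graphon.{v}) (c : Coupling W₁.μ W₂.μ) :
    Integrable (fun z : c.space × c.space => W₁.W (c.φ₁ z.1) (c.φ₁ z.2) -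
      W₂.W (c.φ₂ z.1) (c.φ₂ z.2)) (c.μ.prod c.μ) := by
  have := c.sigmaFinite
  refine Integrable.sub
    (integrable_pullback (A := univ) c.measurePreserving₁.measurable ?_ (by simp) W₁.integrable)
    (integrable_pullback (A := univ) c.measurePreserving₂.measurable ?_ (by simp) W₂.integrable)
  · rw [Measure.restrict_univ, c.measurePreserving₁.map_eq]
  · rw [Measure.restrict_univ, c.measurePreserving₂.map_eq]

section Push

variable {X : Type*} [MeasurableSpace X]

/-- The kernel on `X` obtained by transporting a graphon along an injection into `X` and extending
it by `0`. -/
noncomputable def push (W : Graphon.{u}) (e : W.space → X) (x y : X) : ℝ :=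
  Function.extend (Prod.map e e) (fun z => W.W z.1 z.2) 0 (x, y)

variable {W : Graphon.{u}} {e : W.space → X}

omit [MeasurableSpace X] in
theorem push_apply (he : Function.Injective e) (x y : W.space) : W.push e (e x) (e y) = W.W x y :=
  (he.prodMap he).extend_apply (fun z => W.W z.1 z.2) 0 (x, y)

omit [MeasurableSpace X] in
theorem push_eq_zero {x y : X} (h : ¬ (x ∈ range e ∧ y ∈ range e)) : W.push e x y = 0 := by
  refine Function.extend_apply' _ _ _ ?_
  rintro ⟨z, hz⟩
  simp only [Prod.map, Prod.mk.injEq] at hz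
  exact h ⟨⟨_, hz.1⟩, ⟨_, hz.2⟩⟩

theorem isWeightedKernel_push {w : X → ℝ} (he : MeasurableEmbedding e) (hwe : ∀ x, w (e x) ≠ 0) :
    IsWeightedKernel w (W.μ.map e) (W.push e) := by
  have hs : SigmaFinite (W.μ.map e) := he.sigmaFinite_map
  refine ⟨?_, fun x y hx => push_eq_zero ?_, fun x y hy => push_eq_zero ?_⟩
  · rw [Measure.map_prod_map _ _ he.measurable he.measurable, (he.prodMap he).integrable_map_iff]
    refine W.integrable.congr (ae_of_all _ fun z => ?_)
    exact (push_apply he.injective z.1 z.2).symm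
  · rintro ⟨⟨z, rfl⟩, -⟩
    exact hwe z hx
  · rintro ⟨-, ⟨z, rfl⟩⟩
    exact hwe z hy

end Push

/-! ### Trivial extensions. -/

section TrivialExtension

theorem IsTrivialExtension.refl (W : Graphon.{u}) : IsTrivialExtension W W :=
  ⟨id, MeasurableEmbedding.id, Measure.comap_id W.μ, fun _ _ => rfl, fun x y h => by simp at h⟩

theorem IsTrivialExtension.trans {W W' W'' : Graphon.{u}} (h : IsTrivialExtension W W')
    (h' : IsTrivialExtension W' W'') : IsTrivialExtension W W'' := by
  obtain ⟨ι, hι, hμ, hW, h0⟩ := h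
  obtain ⟨ι', hι', hμ', hW', h0'⟩ := h'
  refine ⟨ι' ∘ ι, hι'.comp hι, ?_, fun x y => by simp [hW, hW'], fun x y hxy => ?_⟩
  · ext s hs
    rw [(hι'.comp hι).comap_apply, image_comp, ← hμ, hι.comap_apply, ← hμ', hι'.comap_apply]
  · by_cases hr : x ∈ range ι' ∧ y ∈ range ι'
    · obtain ⟨⟨a, rfl⟩, ⟨b, rfl⟩⟩ := hr
      rw [hW']
      refine h0 a b fun hab => hxy ?_
      obtain ⟨⟨a, rfl⟩, ⟨b, rfl⟩⟩ := hab
      exact ⟨⟨a, rfl⟩, ⟨b, rfl⟩⟩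
    · exact h0' x y hr

variable {X : Type*} [MeasurableSpace X]

/-- Given an embedding `e` of the space of a graphon, a trivial extension is mapped to the same
space by sending the added points to a point at infinity. -/
theorem IsTrivialExtension.exists_extend {W W' : Graphon.{u}} (h : IsTrivialExtension W W')
    {w : X → ℝ} {e : W.space → X} (he : MeasurableEmbedding e) (hwe : ∀ x, w (e x) ≠ 0) {x₀ : X}
    (hx₀ : w x₀ = 0) :
    ∃ e' : W'.space → X, Measurable e' ∧ (∀ x y, W.push e (e' x) (e' y) = W'.W x y) ∧
      (W'.μ.restrict {x | w (e' x) ≠ 0}).map e' = W.μ.map e := by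
  obtain ⟨ι, hι, hμ, hW, h0⟩ := h
  have hι' : ∀ x, Function.extend ι e (fun _ => x₀) (ι x) = e x := fun x =>
    hι.injective.extend_apply _ _ _
  have hx₀' : ∀ y, y ∉ range ι → Function.extend ι e (fun _ => x₀) y = x₀ := fun y hy =>
    Function.extend_apply' _ _ _ (by simpa using hy)
  have hx₀r : x₀ ∉ range e := by
    rintro ⟨z, rfl⟩
    exact hwe z hx₀
  have hmeas : Measurable (Function.extend ι e fun _ => x₀) :=
    hι.measurable_extend he.measurable measurable_const
  refine ⟨Function.extend ι e fun _ => x₀, hmeas, fun x y => ?_, ?_⟩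
  · by_cases hr : x ∈ range ι ∧ y ∈ range ι
    · obtain ⟨⟨a, rfl⟩, ⟨b, rfl⟩⟩ := hr
      rw [hι', hι', hW, push_apply he.injective]
    · rw [h0 x y hr]
      refine push_eq_zero fun hh => hr ⟨?_, ?_⟩
      · by_contra hc
        exact hx₀r (hx₀' x hc ▸ hh.1)
      · by_contra hc
        exact hx₀r (hx₀' y hc ▸ hh.2)
  · have hset : {x | w (Function.extend ι e (fun _ => x₀) x) ≠ 0} = range ι := by
      ext y
      by_cases hy : y ∈ range ι
      · obtain ⟨a, rfl⟩ := hy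
        simp [hι', hwe]
      · simp only [mem_ofPred_eq, hx₀' y hy, hx₀, ne_eq, not_true, hy]
    rw [hset, ← hι.map_comap, hμ, Measure.map_map hmeas hι.measurable]
    congr 1
    ext x
    exact hι' x

/-- The extension by `0` of a graphon to the disjoint union with another space. -/
def sumFun (W : Graphon.{u}) (X : Type*) : W.space ⊕ X → W.space ⊕ X → ℝ
  | Sum.inl x, Sum.inl y => W.W x y
  | _, _ => 0

/-- The trivial extension of a graphon to the disjoint union with another space, for any measure
that extends the given one. -/
def sumExtend (W : Graphon.{u}) {X : Type} [MeasurableSpace X] (M : Measure (W.space ⊕ X))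
    [SigmaFinite M] (hM : M.restrict (range Sum.inl) = W.μ.map Sum.inl) : Graphon.{u} where
  space := W.space ⊕ X
  μ := M
  W := W.sumFun X
  symm := by
    rintro (x | x) (y | y)
    · exact W.symm x y
    all_goals rfl
  integrable := by
    have e := measurableEmbedding_inl' W.space X
    have hs : SigmaFinite (W.μ.map (Sum.inl : W.space → W.space ⊕ X)) := e.sigmaFinite_map
    rw [← integrableOn_iff_integrable_of_support_subset
      (s := range Sum.inl ×ˢ range Sum.inl), IntegrableOn, ← Measure.prod_restrict, hM,
      Measure.map_prod_map _ _ measurable_inl measurable_inl, (e.prodMap e).integrable_map_iff]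
    · exact W.integrable
    · rintro ⟨x | x, y | y⟩ h <;> simp [sumFun] at h ⊢

theorem isTrivialExtension_sumExtend (W : Graphon.{u}) {X : Type} [MeasurableSpace X]
    (M : Measure (W.space ⊕ X)) [SigmaFinite M]
    (hM : M.restrict (range Sum.inl) = W.μ.map Sum.inl) :
    IsTrivialExtension W (W.sumExtend M hM) := by
  have e := measurableEmbedding_inl' W.space X
  refine ⟨Sum.inl, e, ?_, fun x y => rfl, ?_⟩
  · change M.comap Sum.inl = W.μ
    have h := e.comap_restrict M (range Sum.inl)
    rw [hM, e.comap_map, preimage_range, Measure.restrict_univ] at h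
    exact h.symm
  · rintro (x | x) (y | y) h
    · exact absurd ⟨⟨x, rfl⟩, ⟨y, rfl⟩⟩ h
    all_goals rfl

end TrivialExtension

/-! ### Passing between partial couplings and couplings of trivial extensions. -/

section Realization

variable {X : Type} [MeasurableSpace X] {w : X → ℝ}

/-- The first marginal of a partial coupling is realized on an extension of the space of the
graphon: the points at infinity are replaced by a copy of the second coordinate. -/
theorem exists_map_sum {W : Graphon.{u}} {e : W.space → X} (he : MeasurableEmbedding e)
    (hw : Measurable w) (hwe : ∀ x, w (e x) ≠ 0) {m₂ : Measure X} [SigmaFinite m₂]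
    {m : Measure (X × X)} (h : IsPartialCoupling w (W.μ.map e) m₂ m) :
    ∃ φ : X × X → W.space ⊕ X, Measurable φ ∧ SigmaFinite (m.map φ) ∧
      (m.map φ).restrict (range Sum.inl) = W.μ.map Sum.inl ∧
      ∀ p q, W.sumFun X (φ p) (φ q) = W.push e p.1 q.1 := by
  classical
  obtain ⟨j, hj, hje⟩ := he.exists_measurable_extend (γ := W.space ⊕ X) measurable_inl
    fun x => ⟨Sum.inr x⟩
  have hje' : ∀ x, j (e x) = Sum.inl x := congr_fun hje
  have hr := he.measurableSet_range
  -- A first coordinate outside the range of `e` is forgotten and the second one recorded instead.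
  -- Keeping the single point at infinity could give an atom of infinite mass.
  let φ : X × X → W.space ⊕ X := fun p => if p.1 ∈ range e then j p.1 else Sum.inr p.2
  have hφ : Measurable φ := Measurable.ite (measurable_fst hr) (hj.comp measurable_fst)
    (measurable_inr.comp measurable_snd)
  have hφl : ∀ x y, φ (e x, y) = Sum.inl x := fun x y => by
    simp only [φ, mem_range_self, if_true, hje']
  have hφr : ∀ x y, x ∉ range e → φ (x, y) = Sum.inr y := fun x y hx => by
    simp only [φ, hx, if_false]
  have hrw : ∀ x ∈ range e, w x ≠ 0 := by
    rintro _ ⟨x, rfl⟩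
    exact hwe x
  have hrestr : (m.map φ).restrict (range Sum.inl) = W.μ.map Sum.inl := by
    have hl : MeasurableSet (range (Sum.inl : W.space → W.space ⊕ X)) := measurableSet_range_inl
    ext s hs
    rw [Measure.restrict_apply hs, Measure.map_apply hφ (hs.inter hl),
      Measure.map_apply measurable_inl hs]
    have : φ ⁻¹' (s ∩ range Sum.inl) = Prod.fst ⁻¹' (e '' (Sum.inl ⁻¹' s)) := by
      ext ⟨x, y⟩
      by_cases hx : x ∈ range e
      · obtain ⟨z, rfl⟩ := hx
        simp [hφl, he.injective.eq_iff]
      · have : ∀ z, e z ≠ x := by simpa using hx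
        simp [hφr x y hx, this]
    rw [this, h.measure_fst_preimage (he.measurableSet_image.2 (measurable_inl hs)),
      he.map_apply, preimage_image_eq _ he.injective]
    exact fun x hx => hrw x (image_subset_range _ _ hx)
  refine ⟨φ, hφ, ?_, hrestr, fun p q => ?_⟩
  · have h1 : SigmaFinite (W.μ.map (Sum.inl : W.space → W.space ⊕ X)) :=
      (measurableEmbedding_inl' W.space X).sigmaFinite_map
    have h2 : SigmaFinite (m₂.map (Sum.inr : X → W.space ⊕ X)) :=
      (measurableEmbedding_inr' W.space X).sigmaFinite_map
    -- Almost every first coordinate outside the range of `e` is at infinity, so the second one is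
    -- not. The measure on the added copy of `X` is therefore dominated by the σ-finite `m₂`.
    have hae : ∀ᵐ p ∂m, p.1 ∉ range e → w p.2 ≠ 0 := by
      have hn : m (Prod.fst ⁻¹' ({x | w x ≠ 0} \ range e)) = 0 := by
        rw [h.measure_fst_preimage ((measurableSet_weight_ne hw).diff hr) fun x hx => hx.1,
          he.map_apply]
        convert measure_empty (μ := W.μ)
        ext x
        simp
      filter_upwards [h.ae_ne, compl_mem_ae_iff.2 hn] with p hp hp' hpr
      exact hp.resolve_left fun hh => hp' ⟨hh, hpr⟩
    refine Measure.sigmaFinite_of_le (W.μ.map Sum.inl + m₂.map Sum.inr)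
      (Measure.le_iff.2 fun s hs => ?_)
    rw [← measure_inter_add_sdiff s (measurableSet_range_inl (α := W.space) (β := X)),
      ← Measure.restrict_apply hs, hrestr, Measure.add_apply]
    refine add_le_add le_rfl ?_
    rw [Measure.map_apply hφ (hs.diff measurableSet_range_inl), Measure.map_apply measurable_inr hs,
      ← h.snd, Measure.map_apply measurable_snd (measurable_inr hs),
      Measure.restrict_apply (measurable_snd (measurable_inr hs))]
    refine measure_mono_ae ?_
    filter_upwards [hae] with p hp hps
    obtain ⟨x, y⟩ := p
    by_cases hx : x ∈ range e
    · obtain ⟨z, rfl⟩ := hx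
      have : φ (e z, y) ∈ s \ range Sum.inl := hps
      simp [hφl] at this
    · have : φ (x, y) ∈ s \ range Sum.inl := hps
      rw [hφr x y hx] at this
      exact ⟨this.1, hp hx⟩
  · obtain ⟨x, y⟩ := p
    obtain ⟨x', y'⟩ := q
    by_cases hx : x ∈ range e
    · obtain ⟨z, rfl⟩ := hx
      by_cases hx' : x' ∈ range e
      · obtain ⟨z', rfl⟩ := hx'
        rw [hφl, hφl]
        exact (push_apply he.injective z z').symm
      · rw [hφl, hφr x' y' hx']
        exact (push_eq_zero fun hh => hx' hh.2).symm
    · rw [hφr x y hx]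
      exact (push_eq_zero fun hh => hx hh.1).symm

/-- Every partial coupling is realized by a special coupling of trivial extensions. -/
theorem exists_trivialExtension_special {W₁ : Graphon.{u}} {W₂ : Graphon.{v}} {e₁ : W₁.space → X}
    {e₂ : W₂.space → X} (he₁ : MeasurableEmbedding e₁) (he₂ : MeasurableEmbedding e₂)
    (hw : Measurable w) (hwe₁ : ∀ x, w (e₁ x) ≠ 0) (hwe₂ : ∀ x, w (e₂ x) ≠ 0)
    {m : Measure (X × X)} (h : IsPartialCoupling w (W₁.μ.map e₁) (W₂.μ.map e₂) m) :
    ∃ (W₁' : Graphon.{u}) (W₂' : Graphon.{v}),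
      IsTrivialExtension W₁ W₁' ∧ IsTrivialExtension W₂ W₂' ∧
      ∃ (ν : Measure (W₁'.space × W₂'.space)) (hν : IsCouplingMeasure W₁'.μ W₂'.μ ν),
        couplingCutNorm W₁' W₂' (Coupling.special ν hν) =
          cutNorm m (diffKernel (W₁.push e₁) (W₂.push e₂)) := by
  have s₁ : SigmaFinite (W₁.μ.map e₁) := he₁.sigmaFinite_map
  have s₂ : SigmaFinite (W₂.μ.map e₂) := he₂.sigmaFinite_map
  obtain ⟨φ₁, hφ₁, hs₁, hr₁, hpush₁⟩ := exists_map_sum he₁ hw hwe₁ h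
  obtain ⟨φ₂', hφ₂', hs₂', hr₂', hpush₂'⟩ := exists_map_sum he₂ hw hwe₂ (h.swap hw)
  let φ₂ : X × X → W₂.space ⊕ X := φ₂' ∘ Prod.swap
  have hφ₂ : Measurable φ₂ := hφ₂'.comp measurable_swap
  have hmap : (m.map Prod.swap).map φ₂' = m.map φ₂ := Measure.map_map hφ₂' measurable_swap
  rw [hmap] at hs₂' hr₂'
  let W₁' := W₁.sumExtend (m.map φ₁) hr₁
  let W₂' := W₂.sumExtend (m.map φ₂) hr₂'
  have hψ : Measurable fun p => (φ₁ p, φ₂ p) := hφ₁.prodMk hφ₂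
  let ν : Measure (W₁'.space × W₂'.space) := m.map fun p => (φ₁ p, φ₂ p)
  have hν : IsCouplingMeasure W₁'.μ W₂'.μ ν :=
    ⟨Measure.map_map measurable_fst hψ, Measure.map_map measurable_snd hψ⟩
  refine ⟨W₁', W₂', isTrivialExtension_sumExtend _ _ _, isTrivialExtension_sumExtend _ _ _, ν, hν, ?_⟩
  have hσ : SigmaFinite ν := (Coupling.special ν hν).sigmaFinite
  have hi := integrable_coupling W₁' W₂' (Coupling.special ν hν)
  refine (@cutNorm_map (W₁'.space × W₂'.space) _ (fun s t => W₁'.W s.1 t.1 - W₂'.W s.2 t.2) _ _ m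
    (fun p => (φ₁ p, φ₂ p)) hψ hσ hi).trans ?_
  congr 1
  ext p q
  exact congr_arg₂ _ (hpush₁ p q) (hpush₂' p.swap q.swap)

/-- Coupling measures of the transported measures come from coupling measures of the original
spaces. -/
theorem exists_special {W₁ : Graphon.{u}} {W₂ : Graphon.{v}} {e₁ : W₁.space → X}
    {e₂ : W₂.space → X} (he₁ : MeasurableEmbedding e₁) (he₂ : MeasurableEmbedding e₂)
    {m : Measure (X × X)} (h : IsCouplingMeasure (W₁.μ.map e₁) (W₂.μ.map e₂) m) :
    ∃ (ν : Measure (W₁.space × W₂.space)) (hν : IsCouplingMeasure W₁.μ W₂.μ ν),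
        couplingCutNorm W₁ W₂ (Coupling.special ν hν) =
          cutNorm m (diffKernel (W₁.push e₁) (W₂.push e₂)) := by
  have hf := he₁.prodMap he₂
  have s₁ : SigmaFinite (W₁.μ.map e₁) := he₁.sigmaFinite_map
  have s₂ : SigmaFinite (W₂.μ.map e₂) := he₂.sigmaFinite_map
  have hae : ∀ᵐ p ∂m, p ∈ range (Prod.map e₁ e₂) := by
    have a₁ : ∀ᵐ x ∂(m.map Prod.fst), x ∈ range e₁ := by
      rw [h.map_fst]
      exact (ae_map_iff he₁.measurable.aemeasurable he₁.measurableSet_range).2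
        (ae_of_all _ fun x => mem_range_self x)
    have a₂ : ∀ᵐ x ∂(m.map Prod.snd), x ∈ range e₂ := by
      rw [h.map_snd]
      exact (ae_map_iff he₂.measurable.aemeasurable he₂.measurableSet_range).2
        (ae_of_all _ fun x => mem_range_self x)
    filter_upwards [ae_of_ae_map measurable_fst.aemeasurable a₁,
      ae_of_ae_map measurable_snd.aemeasurable a₂] with p h₁ h₂
    rw [range_prodMap]
    exact ⟨h₁, h₂⟩
  have hmap : (m.comap (Prod.map e₁ e₂)).map (Prod.map e₁ e₂) = m := by
    rw [hf.map_comap, Measure.restrict_eq_self_of_ae_mem hae]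
  have hν : IsCouplingMeasure W₁.μ W₂.μ (m.comap (Prod.map e₁ e₂)) := by
    constructor
    · rw [← he₁.comap_map ((m.comap (Prod.map e₁ e₂)).map Prod.fst),
        Measure.map_map he₁.measurable measurable_fst]
      change Measure.comap e₁ (Measure.map (Prod.fst ∘ Prod.map e₁ e₂) _) = _
      rw [← Measure.map_map measurable_fst hf.measurable, hmap, h.map_fst, he₁.comap_map]
    · rw [← he₂.comap_map ((m.comap (Prod.map e₁ e₂)).map Prod.snd),
        Measure.map_map he₂.measurable measurable_snd]
      change Measure.comap e₂ (Measure.map (Prod.snd ∘ Prod.map e₁ e₂) _) = _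
      rw [← Measure.map_map measurable_snd hf.measurable, hmap, h.map_snd, he₂.comap_map]
  refine ⟨_, hν, ?_⟩
  -- With weight constantly 1 nothing is at infinity, so the results on partial couplings apply to
  -- coupling measures.
  have hm := h.isPartialCoupling (w := fun _ => 1) measurable_const (by simp) (by simp)
  have := hm.sigmaFinite
  have hi := hm.integrable_diffKernel (isWeightedKernel_push he₁ fun x => one_ne_zero)
    (isWeightedKernel_push he₂ fun x => one_ne_zero)
  have hσ : SigmaFinite ((m.comap (Prod.map e₁ e₂)).map (Prod.map e₁ e₂)) := by rwa [hmap]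
  conv_rhs => rw [← hmap]
  rw [cutNorm_map hf.measurable (by rwa [hmap])]
  unfold couplingCutNorm
  congr 1
  ext s t
  exact congr_arg₂ _ (push_apply he₁.injective _ _).symm (push_apply he₂.injective _ _).symm

/-- Every coupling of trivial extensions induces a partial coupling of the transported measures. -/
theorem exists_isPartialCoupling {W₁ W₁' : Graphon.{u}} {W₂ W₂' : Graphon.{v}} {e₁ : W₁.space → X}
    {e₂ : W₂.space → X} (he₁ : MeasurableEmbedding e₁) (he₂ : MeasurableEmbedding e₂)
    (hw : Measurable w) (hwe₁ : ∀ x, w (e₁ x) ≠ 0) (hwe₂ : ∀ x, w (e₂ x) ≠ 0) {x₀ : X}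
    (hx₀ : w x₀ = 0) (h₁ : IsTrivialExtension W₁ W₁') (h₂ : IsTrivialExtension W₂ W₂')
    (c : Coupling W₁'.μ W₂'.μ) :
    ∃ m, IsPartialCoupling w (W₁.μ.map e₁) (W₂.μ.map e₂) m ∧
      cutNorm m (diffKernel (W₁.push e₁) (W₂.push e₂)) = couplingCutNorm W₁' W₂' c := by
  have s₁ : SigmaFinite (W₁.μ.map e₁) := he₁.sigmaFinite_map
  have s₂ : SigmaFinite (W₂.μ.map e₂) := he₂.sigmaFinite_map
  have := c.sigmaFinite
  obtain ⟨E₁, hE₁, hp₁, hm₁⟩ := h₁.exists_extend he₁ hwe₁ hx₀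
  obtain ⟨E₂, hE₂, hp₂, hm₂⟩ := h₂.exists_extend he₂ hwe₂ hx₀
  have c₁ := c.measurePreserving₁
  have c₂ := c.measurePreserving₂
  obtain ⟨m, hm, hcut, -⟩ := exists_isPartialCoupling_of_maps (μ := c.μ) hw
    (hE₁.comp c₁.measurable) (hE₂.comp c₂.measurable) (m₁ := W₁.μ.map e₁) (m₂ := W₂.μ.map e₂)
    (by
      rw [← Measure.map_map hE₁ c₁.measurable]
      exact (congrArg (Measure.map E₁) (c₁.restrict_preimage
        (hE₁ (measurableSet_weight_ne hw))).map_eq).trans hm₁)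
    (by
      rw [← Measure.map_map hE₂ c₂.measurable]
      exact (congrArg (Measure.map E₂) (c₂.restrict_preimage
        (hE₂ (measurableSet_weight_ne hw))).map_eq).trans hm₂)
    (isWeightedKernel_push he₁ hwe₁) (isWeightedKernel_push he₂ hwe₂)
  refine ⟨m, hm, hcut.trans ?_⟩
  simp only [Function.comp, hp₁, hp₂]
  rfl

/-- A coupling induces a coupling measure of the transported measures. -/
theorem exists_isCouplingMeasure {W₁ : Graphon.{u}} {W₂ : Graphon.{v}} {e₁ : W₁.space → X}
    {e₂ : W₂.space → X} (he₁ : MeasurableEmbedding e₁) (he₂ : MeasurableEmbedding e₂)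
    (c : Coupling W₁.μ W₂.μ) :
    ∃ m, IsCouplingMeasure (W₁.μ.map e₁) (W₂.μ.map e₂) m ∧
      cutNorm m (diffKernel (W₁.push e₁) (W₂.push e₂)) = couplingCutNorm W₁ W₂ c := by
  have s₁ : SigmaFinite (W₁.μ.map e₁) := he₁.sigmaFinite_map
  have s₂ : SigmaFinite (W₂.μ.map e₂) := he₂.sigmaFinite_map
  have c₁ := c.measurePreserving₁
  have c₂ := c.measurePreserving₂
  have hE : Measurable fun s => (e₁ (c.φ₁ s), e₂ (c.φ₂ s)) :=
    (he₁.measurable.comp c₁.measurable).prodMk (he₂.measurable.comp c₂.measurable)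
  have hm : IsCouplingMeasure (W₁.μ.map e₁) (W₂.μ.map e₂)
      (c.μ.map fun s => (e₁ (c.φ₁ s), e₂ (c.φ₂ s))) := by
    constructor
    · rw [Measure.map_map measurable_fst hE]
      exact (Measure.map_map he₁.measurable c₁.measurable).symm.trans
        (congrArg (Measure.map e₁) c₁.map_eq)
    · rw [Measure.map_map measurable_snd hE]
      exact (Measure.map_map he₂.measurable c₂.measurable).symm.trans
        (congrArg (Measure.map e₂) c₂.map_eq)
  have hp := hm.isPartialCoupling (w := fun _ => 1) measurable_const (by simp) (by simp)
  have := hp.sigmaFinite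
  refine ⟨_, hm, ?_⟩
  rw [cutNorm_map hE (hp.integrable_diffKernel (isWeightedKernel_push he₁ fun x => one_ne_zero)
    (isWeightedKernel_push he₂ fun x => one_ne_zero))]
  simp only [diffKernel, push_apply he₁.injective, push_apply he₂.injective]
  rfl

end Realization

end Graphon

/-! ### Embedding a standard Borel space in the weighted square. -/

section Embedding

/-- The weight on the square: the first coordinate. -/
def squareWeight (p : unitInterval × unitInterval) : ℝ := p.1

theorem continuous_squareWeight : Continuous squareWeight := by
  unfold squareWeight
  fun_prop

/-- The embedding of a standard Borel space into the square with prescribed first coordinate. -/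
noncomputable def squareEmbedding {S : Type*} [MeasurableSpace S] [StandardBorelSpace S]
    (g : S → unitInterval) (x : S) : unitInterval × unitInterval :=
  (g x, unitInterval.sigmoid (embeddingReal S x))

/-- The second coordinate alone is injective, which leaves the first free to carry any measurable
weight. -/
theorem measurableEmbedding_squareEmbedding {S : Type*} [MeasurableSpace S] [StandardBorelSpace S]
    {g : S → unitInterval} (hg : Measurable g) : MeasurableEmbedding (squareEmbedding g) := by
  have h := measurableEmbedding_sigmoid_comp_embeddingReal S
  exact (hg.prodMk h.measurable).measurableEmbedding fun x y hxy => h.injective (Prod.ext_iff.1 hxy).2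

theorem integrable_squareWeight_map {S : Type*} [MeasurableSpace S] [StandardBorelSpace S]
    {μ : Measure S} {g : S → unitInterval} (hg : Measurable g)
    (hi : Integrable (fun x => (g x : ℝ)) μ) :
    Integrable squareWeight (μ.map (squareEmbedding g)) :=
  (measurableEmbedding_squareEmbedding hg).integrable_map_iff.2 hi

theorem exists_pos_integrable_unitInterval {S : Type*} [MeasurableSpace S] (μ : Measure S)
    [SigmaFinite μ] : ∃ g : S → unitInterval, Measurable g ∧ (∀ x, (g x : ℝ) ≠ 0) ∧
      Integrable (fun x => (g x : ℝ)) μ := by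
  obtain ⟨g, hg0, hg, hint⟩ := exists_pos_lintegral_lt_of_sigmaFinite μ one_ne_zero
  have hm : Measurable fun x => min (g x : ℝ) 1 := hg.coe_nnreal_real.min measurable_const
  have h0 : ∀ x, 0 < min (g x : ℝ) 1 := fun x => lt_min (by exact_mod_cast hg0 x) one_pos
  refine ⟨fun x => ⟨min (g x : ℝ) 1, (h0 x).le, min_le_right _ _⟩, hm.subtype_mk,
    fun x => (h0 x).ne', ?_⟩
  have hgi : Integrable (fun x => (g x : ℝ)) μ := by
    refine ⟨hg.coe_nnreal_real.aestronglyMeasurable, ?_⟩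
    rw [hasFiniteIntegral_iff_enorm]
    simpa using hint.trans ENNReal.one_lt_top
  refine hgi.mono hm.aestronglyMeasurable (ae_of_all _ fun x => ?_)
  rw [Real.norm_eq_abs, Real.norm_eq_abs, abs_of_pos (h0 x)]
  exact (min_le_left _ _).trans (le_abs_self _)

end Embedding

/-! ### Attainment for equal finite masses and for infinite masses. -/

namespace Graphon

theorem cutDistOfMassEq_le (W₁ : Graphon.{u}) (W₂ : Graphon.{v}) (c : Coupling W₁.μ W₂.μ) :
    cutDistOfMassEq W₁ W₂ ≤ couplingCutNorm W₁ W₂ c :=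
  ciInf_le (bddBelow_couplingCutNorm W₁ W₂) c

theorem _root_.IsCouplingMeasure.compl_eq_zero {X : Type*} [MeasurableSpace X] {m₁ m₂ : Measure X}
    {m : Measure (X × X)} (h : IsCouplingMeasure m₁ m₂ m) {s : Set X} (hs : MeasurableSet s)
    (h₁ : m₁ sᶜ = 0) (h₂ : m₂ sᶜ = 0) : m (s ×ˢ s)ᶜ = 0 := by
  rw [← h.map_fst, Measure.map_apply measurable_fst hs.compl] at h₁
  rw [← h.map_snd, Measure.map_apply measurable_snd hs.compl] at h₂
  rw [compl_prod_eq_union]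
  refine measure_union_null (measure_mono_null ?_ h₁) (measure_mono_null ?_ h₂)
  · exact fun p hp => hp.1
  · exact fun p hp => hp.2

/-- For spaces of the same finite mass the infimum over all couplings is attained by a special
coupling. -/
theorem exists_special_eq_cutDistOfMassEq (W₁ : Graphon.{u}) (W₂ : Graphon.{v})
    [StandardBorelSpace W₁.space] [StandardBorelSpace W₂.space] (h : W₁.μ univ = W₂.μ univ)
    (hfin : W₁.μ univ ≠ ∞) :
    ∃ (ν : Measure (W₁.space × W₂.space)) (hν : IsCouplingMeasure W₁.μ W₂.μ ν),
      cutDistOfMassEq W₁ W₂ = couplingCutNorm W₁ W₂ (Coupling.special ν hν) := by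
  have f₁ : IsFiniteMeasure W₁.μ := ⟨hfin.lt_top⟩
  have f₂ : IsFiniteMeasure W₂.μ := ⟨h ▸ hfin.lt_top⟩
  have he₁ := measurableEmbedding_squareEmbedding (S := W₁.space) (g := fun _ => 1) measurable_const
  have he₂ := measurableEmbedding_squareEmbedding (S := W₂.space) (g := fun _ => 1) measurable_const
  have hw₁ : ∀ x : W₁.space, squareWeight (squareEmbedding (fun _ => 1) x) = 1 := fun _ => rfl
  have hw₂ : ∀ x : W₂.space, squareWeight (squareEmbedding (fun _ => 1) x) = 1 := fun _ => rfl
  have hi₁ := integrable_squareWeight_map (μ := W₁.μ) (g := fun _ => 1) measurable_const (by simp)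
  have hi₂ := integrable_squareWeight_map (μ := W₂.μ) (g := fun _ => 1) measurable_const (by simp)
  set e₁ : W₁.space → unitInterval × unitInterval := squareEmbedding fun _ => 1
  set e₂ : W₂.space → unitInterval × unitInterval := squareEmbedding fun _ => 1
  have hcont := continuous_squareWeight
  have h0 : ∀ x, 0 ≤ squareWeight x := fun x => x.1.2.1
  have s₁ : SigmaFinite (W₁.μ.map e₁) := he₁.sigmaFinite_map
  have s₂ : SigmaFinite (W₂.μ.map e₂) := he₂.sigmaFinite_map
  -- The images lie in the closed set `s`, which is away from infinity. Confining the minimization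
  -- to `s ×ˢ s` keeps mass from escaping in the limit.
  let s : Set (unitInterval × unitInterval) := squareWeight ⁻¹' {1}
  have hsc : IsClosed s := isClosed_singleton.preimage hcont
  have hz₁ : W₁.μ.map e₁ sᶜ = 0 := by
    rw [he₁.map_apply]
    convert measure_empty (μ := W₁.μ)
    ext x
    simp [s, hw₁]
  have hz₂ : W₂.μ.map e₂ sᶜ = 0 := by
    rw [he₂.map_apply]
    convert measure_empty (μ := W₂.μ)
    ext x
    simp [s, hw₂]
  have hsub : {x | squareWeight x = 0} ⊆ sᶜ := fun x hx hx' =>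
    zero_ne_one ((show squareWeight x = 0 from hx).symm.trans hx')
  have k₁ := isWeightedKernel_push (W := W₁) (w := squareWeight) he₁ fun x => by simp [hw₁ x]
  have k₂ := isWeightedKernel_push (W := W₂) (w := squareWeight) he₂ fun x => by simp [hw₂ x]
  have toPartial : ∀ m, IsCouplingMeasure (W₁.μ.map e₁) (W₂.μ.map e₂) m →
      IsPartialCoupling squareWeight (W₁.μ.map e₁) (W₂.μ.map e₂) m ∧ m (s ×ˢ s)ᶜ = 0 := fun m hm =>
    ⟨hm.isPartialCoupling hcont.measurable (measure_mono_null hsub hz₁)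
      (measure_mono_null hsub hz₂), hm.compl_eq_zero hsc.measurableSet hz₁ hz₂⟩
  have hex : ∃ m, IsCouplingMeasure (W₁.μ.map e₁) (W₂.μ.map e₂) m :=
    IsCouplingMeasure.exists_of_measure_univ_eq hfin
      (by rw [he₁.map_apply, preimage_univ]) (by rw [he₂.map_apply, preimage_univ, h])
  obtain ⟨m, ⟨hm, hmK⟩, hmin⟩ := exists_isPartialCoupling_minimizer hcont h0 hi₁ hi₂ k₁ k₂
    (hsc.prod hsc) ⟨_, toPartial _ hex.choose_spec⟩
  have hae : ∀ᵐ p ∂m, p ∈ s ×ˢ s := hmK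
  have hne : ∀ x ∈ s, squareWeight x ≠ 0 := fun x hx => by
    rw [show squareWeight x = 1 from hx]
    exact one_ne_zero
  -- On `s ×ˢ s` neither weight vanishes, so the restrictions in the marginal conditions are void
  -- and the minimizer is a genuine coupling.
  have hmc : IsCouplingMeasure (W₁.μ.map e₁) (W₂.μ.map e₂) m := by
    constructor
    · conv_rhs => rw [← hm.fst]
      rw [Measure.restrict_eq_self_of_ae_mem]
      filter_upwards [hae] with p hp using hne _ hp.1
    · conv_rhs => rw [← hm.snd]
      rw [Measure.restrict_eq_self_of_ae_mem]
      filter_upwards [hae] with p hp using hne _ hp.2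
  obtain ⟨ν, hν, heq⟩ := exists_special he₁ he₂ hmc
  refine ⟨ν, hν, le_antisymm (cutDistOfMassEq_le _ _ _) ?_⟩
  have : Nonempty (Coupling W₁.μ W₂.μ) := ⟨Coupling.special ν hν⟩
  refine le_ciInf fun c => ?_
  obtain ⟨m', hm', hc⟩ := exists_isCouplingMeasure he₁ he₂ c
  rw [heq, ← hc]
  exact hmin m' (toPartial m' hm').1 (toPartial m' hm').2

/-- For spaces of infinite mass, the cut distance is attained by a special coupling of trivial
extensions. -/
theorem exists_trivialExtension_of_mass_eq_top (W₁ : Graphon.{u}) (W₂ : Graphon.{v})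
    [StandardBorelSpace W₁.space] [StandardBorelSpace W₂.space] (htop₁ : W₁.μ univ = ∞)
    (htop₂ : W₂.μ univ = ∞) :
    ∃ (W₁' : Graphon.{u}) (W₂' : Graphon.{v}),
      IsTrivialExtension W₁ W₁' ∧ IsTrivialExtension W₂ W₂' ∧
      ∃ (ν : Measure (W₁'.space × W₂'.space)) (hν : IsCouplingMeasure W₁'.μ W₂'.μ ν),
        cutDist W₁ W₂ = cutDist W₁' W₂' ∧
        cutDist W₁' W₂' = couplingCutNorm W₁' W₂' (Coupling.special ν hν) := by
  obtain ⟨g₁, hg₁, hg₁0, hgi₁⟩ := exists_pos_integrable_unitInterval W₁.μ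
  obtain ⟨g₂, hg₂, hg₂0, hgi₂⟩ := exists_pos_integrable_unitInterval W₂.μ
  have he₁ := measurableEmbedding_squareEmbedding hg₁
  have he₂ := measurableEmbedding_squareEmbedding hg₂
  have hwe₁ : ∀ x, squareWeight (squareEmbedding g₁ x) ≠ 0 := hg₁0
  have hwe₂ : ∀ x, squareWeight (squareEmbedding g₂ x) ≠ 0 := hg₂0
  have hi₁ := integrable_squareWeight_map hg₁ hgi₁
  have hi₂ := integrable_squareWeight_map hg₂ hgi₂
  set e₁ := squareEmbedding g₁
  set e₂ := squareEmbedding g₂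
  have hcont := continuous_squareWeight
  have hmeas := hcont.measurable
  have h0 : ∀ x, 0 ≤ squareWeight x := fun x => x.1.2.1
  have hx₀ : squareWeight (0, 0) = 0 := rfl
  have s₁ : SigmaFinite (W₁.μ.map e₁) := he₁.sigmaFinite_map
  have s₂ : SigmaFinite (W₂.μ.map e₂) := he₂.sigmaFinite_map
  have k₁ := isWeightedKernel_push (W := W₁) (w := squareWeight) he₁ hwe₁
  have k₂ := isWeightedKernel_push (W := W₂) (w := squareWeight) he₂ hwe₂
  have t₁ : W₁.μ.map e₁ univ = ∞ := by rw [he₁.map_apply, preimage_univ, htop₁]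
  have t₂ : W₂.μ.map e₂ univ = ∞ := by rw [he₂.map_apply, preimage_univ, htop₂]
  -- Some coupling exists: both infinite measures are cut into unit masses, which are coupled one by
  -- one.
  have hne : ∃ m, IsPartialCoupling squareWeight (W₁.μ.map e₁) (W₂.μ.map e₂) m ∧ m univᶜ = 0 := by
    obtain ⟨r₁, hr₁, hsum₁⟩ := exists_sum_eq_of_measure_univ_eq_top (W₁.μ.map e₁) t₁
      (b := fun _ => 1) (by simp)
    obtain ⟨r₂, hr₂, hsum₂⟩ := exists_sum_eq_of_measure_univ_eq_top (W₂.μ.map e₂) t₂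
      (b := fun _ => 1) (by simp)
    choose γ hγ using fun n => IsCouplingMeasure.exists_of_measure_univ_eq ENNReal.coe_ne_top
      (hr₁ n) (hr₂ n)
    have hc := IsCouplingMeasure.sum hγ
    rw [hsum₁, hsum₂] at hc
    refine ⟨_, hc.isPartialCoupling hmeas ?_ ?_, by simp⟩
    · rw [he₁.map_apply]
      simp [hwe₁]
    · rw [he₂.map_apply]
      simp [hwe₂]
  obtain ⟨m, ⟨hm, -⟩, hmin⟩ := exists_isPartialCoupling_minimizer hcont h0 hi₁ hi₂ k₁ k₂
    isClosed_univ hne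
  obtain ⟨W₁', W₂', hW₁, hW₂, ν, hν, hνm⟩ :=
    exists_trivialExtension_special he₁ he₂ hmeas hwe₁ hwe₂ hm
  have hmass : W₁'.μ univ = W₂'.μ univ := by
    rw [← hν.map_fst, ← hν.map_snd, Measure.map_apply measurable_fst .univ,
      Measure.map_apply measurable_snd .univ, preimage_univ, preimage_univ]
  -- The minimum is a lower bound for couplings of all trivial extensions at once, in particular of
  -- `W₁'`, `W₂'` and of `W₁`, `W₂` themselves.
  have lower : ∀ {V₁ : Graphon.{u}} {V₂ : Graphon.{v}}, IsTrivialExtension W₁ V₁ →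
      IsTrivialExtension W₂ V₂ → ∀ c : Coupling V₁.μ V₂.μ,
      cutNorm m (diffKernel (W₁.push e₁) (W₂.push e₂)) ≤ couplingCutNorm V₁ V₂ c := by
    intro V₁ V₂ h₁ h₂ c
    obtain ⟨m', hm', hc⟩ := exists_isPartialCoupling he₁ he₂ hmeas hwe₁ hwe₂ hx₀ h₁ h₂ c
    rw [← hc]
    exact hmin m' hm' (by simp)
  have eq' : cutDist W₁' W₂' = cutNorm m (diffKernel (W₁.push e₁) (W₂.push e₂)) := by
    rw [cutDist, if_pos hmass]
    have : Nonempty (Coupling W₁'.μ W₂'.μ) := ⟨Coupling.special ν hν⟩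
    exact le_antisymm ((cutDistOfMassEq_le _ _ _).trans_eq hνm) (le_ciInf (lower hW₁ hW₂))
  have eq : cutDist W₁ W₂ = cutNorm m (diffKernel (W₁.push e₁) (W₂.push e₂)) := by
    rw [cutDist, if_pos (htop₁.trans htop₂.symm)]
    -- On the original spaces the minimum need not be attained, but true couplings come arbitrarily
    -- close to it.
    have approx : ∀ ε : ℝ, 0 < ε → ∃ c : Coupling W₁.μ W₂.μ, couplingCutNorm W₁ W₂ c ≤
        cutNorm m (diffKernel (W₁.push e₁) (W₂.push e₂)) + ε := by
      intro ε hε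
      obtain ⟨m', hm', hle⟩ := hm.exists_isCouplingMeasure_cutNorm_le hmeas h0 hx₀ hi₁ hi₂ t₁ t₂
        k₁ k₂ hε
      obtain ⟨ν', hν', heq⟩ := exists_special he₁ he₂ hm'
      exact ⟨_, heq.trans_le hle⟩
    have : Nonempty (Coupling W₁.μ W₂.μ) := ⟨(approx 1 one_pos).choose⟩
    refine le_antisymm (le_of_forall_pos_le_add fun ε hε => ?_)
      (le_ciInf (lower (.refl W₁) (.refl W₂)))
    obtain ⟨c, hc⟩ := approx ε hε
    exact (cutDistOfMassEq_le _ _ c).trans hc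
  exact ⟨W₁', W₂', hW₁, hW₂, ν, hν, eq.trans eq'.symm, eq'.trans hνm.symm⟩

end Graphon

/-! ### Disjoint unions of standard Borel spaces, and the theorem. -/

theorem borelSpace_sum (α β : Type*) [TopologicalSpace α] [MeasurableSpace α] [BorelSpace α]
    [TopologicalSpace β] [MeasurableSpace β] [BorelSpace β] : BorelSpace (α ⊕ β) := by
  refine ⟨le_antisymm (fun s hs => ?_) (MeasurableSpace.generateFrom_le fun s hs => ?_)⟩
  · obtain ⟨h₁, h₂⟩ := measurableSet_sum_iff.1 hs
    borelize (α ⊕ β)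
    rw [← image_preimage_inl_union_image_preimage_inr s]
    exact (Topology.IsOpenEmbedding.inl.measurableEmbedding.measurableSet_image.2 h₁).union
      (Topology.IsOpenEmbedding.inr.measurableEmbedding.measurableSet_image.2 h₂)
  · exact measurableSet_sum_iff.2 ⟨(hs.preimage continuous_inl).measurableSet,
      (hs.preimage continuous_inr).measurableSet⟩

/-- Needed so that adjoining a half-line keeps the space of a graphon standard Borel. -/
theorem standardBorelSpace_sum (α β : Type*) [MeasurableSpace α] [StandardBorelSpace α]
    [MeasurableSpace β] [StandardBorelSpace β] : StandardBorelSpace (α ⊕ β) := by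
  let _ := upgradeStandardBorel α
  let _ := upgradeStandardBorel β
  have := borelSpace_sum α β
  infer_instance

theorem theorem5p1 (W₁ : Graphon.{u}) (W₂ : Graphon.{v})
    [StandardBorelSpace W₁.space] [StandardBorelSpace W₂.space] :
    ∃ (W₁' : Graphon.{u}) (W₂' : Graphon.{v}),
      Graphon.IsTrivialExtension W₁ W₁' ∧ Graphon.IsTrivialExtension W₂ W₂' ∧
      ∃ (ν : Measure (W₁'.space × W₂'.space)) (hν : IsCouplingMeasure W₁'.μ W₂'.μ ν),
        Graphon.cutDist W₁ W₂ = Graphon.cutDist W₁' W₂' ∧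
        Graphon.cutDist W₁' W₂' =
          Graphon.couplingCutNorm W₁' W₂' (Coupling.special ν hν) := by
  by_cases h : W₁.μ univ = W₂.μ univ
  · by_cases htop : W₁.μ univ = ∞
    · exact Graphon.exists_trivialExtension_of_mass_eq_top W₁ W₂ htop (h ▸ htop)
    · obtain ⟨ν, hν, heq⟩ := Graphon.exists_special_eq_cutDistOfMassEq W₁ W₂ h htop
      refine ⟨W₁, W₂, .refl W₁, .refl W₂, ν, hν, rfl, ?_⟩
      rw [Graphon.cutDist, if_pos h, heq]
  -- For unequal masses the cut metric is by definition that of the half-line extensions, which both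
  -- have infinite mass; trivial extensions compose.
  · have hI : StandardBorelSpace (Ici (0 : ℝ)) := measurableSet_Ici.standardBorel
    have b₁ : StandardBorelSpace W₁.addHalfLine.space :=
      standardBorelSpace_sum W₁.space (Ici (0 : ℝ))
    have b₂ : StandardBorelSpace W₂.addHalfLine.space :=
      standardBorelSpace_sum W₂.space (Ici (0 : ℝ))
    obtain ⟨W₁', W₂', h₁, h₂, ν, hν, heq, heq'⟩ := Graphon.exists_trivialExtension_of_mass_eq_top
      W₁.addHalfLine W₂.addHalfLine W₁.addHalfLine_mass W₂.addHalfLine_mass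
    refine ⟨W₁', W₂', W₁.isTrivialExtension_addHalfLine.trans h₁,
      W₂.isTrivialExtension_addHalfLine.trans h₂, ν, hν, ?_, heq'⟩
    rw [← heq, Graphon.cutDist, if_neg h, Graphon.cutDist,
      if_pos (W₁.addHalfLine_mass.trans W₂.addHalfLine_mass.symm)]
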